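/- **The model.** Fix $\gamma>1$, an integer $n\ge 1$ and weights $a_1,\dots,a_n>0$. For every $N\ge n$ let $k(1,N),\dots,k(n,N)\ge 1$ be integers with $\sum_{i=1}^n k(i,N)=N$, and assume that $k(i,N)/N\to p_i$ as $N\to\infty$ for $1\le i\le n$, with $p_1>0$ (the other $p_i$ may vanish). Write a configuration of $N$ spins as $\sigma=\sigma_1\cdots\sigma_n$ with $\sigma_i\in 2^{k(i,N)}$, a branch of the $n$-level tree whose nodes at level $i$ are the strings $\sigma_1\cdots\sigma_i$. On one probability space, let for each $N\ge n$ the random variables $\xi(\sigma_1\cdots\sigma_i)$, one for every node of level $1,\dots,n$ of the $N$-th tree, be i.i.d. with density $$\phi_{N,\gamma}(x)=\frac{1}{2\Gamma(1/\gamma)}\Big(\frac{\gamma}{N}\Big)^{\frac{\gamma-1}{\gamma}}\exp\Big(-\frac{|x|^\gamma}{\gamma N^{\gamma-1}}\Big),\qquad x\in\mathbb R$$ (nothing is assumed on the joint law for different $N$). Put $H_N(\sigma)=\sum_{i=1}^n a_i\,\xi(\sigma_1\cdots\sigma_i)$ and $Z_N(\beta)=\sum_\sigma e^{-\beta H_N(\sigma)}$.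 **Critical parameters.** For $1\le j\le k\le n$ let $$B(j,k)=\left(\frac{(p_j+\cdots+p_k)\,\gamma\log 2}{a_j^{\gamma/(\gamma-1)}+\cdots+a_k^{\gamma/(\gamma-1)}}\right)^{\frac{\gamma-1}{\gamma}}.$$ Put $r_0=0$, $\beta_0=0$ and, as long as $r_l<n$, $$\beta_{l+1}=\min_{r_l<k\le n}B(r_l+1,k),\qquad r_{l+1}=\max\{i: r_l<i\le n,\ B(r_l+1,i)=\beta_{l+1}\}.$$ **Theorem.** There is a $K$ with $1\le K\le n$, $0=r_0<r_1<\dots<r_K=n$ and $0=\beta_0<\beta_1<\dots<\beta_K$. Almost surely, for every $\beta>0$, $$\lim_{N\to\infty}\frac1N\log Z_N(\beta)=\sum_{i=r_j+1}^n p_i\log 2+\frac{\gamma-1}{\gamma}\sum_{i=r_j+1}^n(\beta a_i)^{\frac{\gamma}{\gamma-1}}+\beta\sum_{l=1}^{j}\beta_l^{\frac1{\gamma-1}}\sum_{i=r_{l-1}+1}^{r_l}a_i^{\frac{\gamma}{\gamma-1}}$$ if $\beta_j<\beta\le\beta_{j+1}$ with $0\le j\le K-1$, and $$\lim_{N\to\infty}\frac1N\log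 Z_N(\beta)=\beta\sum_{l=1}^{K}\beta_l^{\frac1{\gamma-1}}\sum_{i=r_{l-1}+1}^{r_l}a_i^{\frac{\gamma}{\gamma-1}}\qquad\text{if }\beta>\beta_K.$$ In the case $\gamma=2$ this is the Gaussian GREM: the $\xi(\sigma_1\cdots\sigma_i)$ are centred Gaussian with variance $N$, $B(j,k)=\sqrt{2\log 2\,(p_j+\cdots+p_k)/(a_j^2+\cdots+a_k^2)}$, and almost surely, for every $\beta>0$, the limit is $\sum_{i>r_j}p_i\log2+\frac{\beta^2}{2}\sum_{i>r_j}a_i^2+\beta\sum_{l=1}^j\beta_l\sum_{i=r_{l-1}+1}^{r_l}a_i^2$ if $\beta_j<\beta\le\beta_{j+1}$, $0\le j\le K-1$, and $\beta\sum_{l=1}^K\beta_l\sum_{i=r_{l-1}+1}^{r_l}a_i^2$ if $\beta>\beta_K$. -/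

import Mathlib

open MeasureTheory ProbabilityTheory Filter Topology
open scoped NNReal ENNReal

noncomputable section

namespace GREM

/-- A node of level `m` of the tree of the `N`-particle system: a string `σ₁ σ₂ ⋯ σₘ` with
`σᵢ ∈ 2 ^ k(i, N)`. The levels are numbered from `1`, so the entry at `j : Fin m` is `σ_{j+1}`. -/
abbrev Word (k : ℕ → ℕ → ℕ) (N m : ℕ) : Type :=
  (j : Fin m) → (Fin (k (j + 1) N) → Bool)

/-- The nodes of the `n`-level tree, the root excluded: `⟨i, σ⟩` is a node of level `i + 1`. -/
abbrev Node (k : ℕ → ℕ → ℕ) (n N : ℕ) : Type :=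
  (i : Fin n) × Word k N (i + 1)

/-- The node `σ₁ ⋯ σ_{i+1}` on the branch `σ = σ₁ ⋯ σₙ`. -/
def ancestor {k : ℕ → ℕ → ℕ} {n N : ℕ} (σ : Word k N n) (i : Fin n) : Node k n N :=
  ⟨i, fun j => σ (Fin.castLE i.isLt j)⟩

/-- The Hamiltonian `H_N(σ) = ∑ᵢ aᵢ ξ(σ₁ ⋯ σᵢ)`, for given values `x` of the variables at the
nodes of the tree. -/
def hamiltonian {k : ℕ → ℕ → ℕ} {n N : ℕ} (a : ℕ → ℝ) (x : Node k n N → ℝ) (σ : Word k N n) : ℝ :=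
  ∑ i : Fin n, a (i + 1) * x (ancestor σ i)

/-- The partition function `Z_N(β) = ∑_σ exp (-β H_N(σ))`. -/
def partitionFunction {k : ℕ → ℕ → ℕ} {n N : ℕ} (a : ℕ → ℝ) (x : Node k n N → ℝ) (β : ℝ) : ℝ :=
  ∑ σ : Word k N n, Real.exp (-β * hamiltonian a x σ)

/-- The density `φ_{N,γ}` of the driving distribution. -/
def drivingDensity (γ : ℝ) (N : ℕ) (x : ℝ) : ℝ :=
  1 / (2 * Real.Gamma (1 / γ)) * (γ / N) ^ ((γ - 1) / γ) *
    Real.exp (-(|x| ^ γ / (γ * (N : ℝ) ^ (γ - 1))))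

/-- The driving distribution, with density `φ_{N,γ}` with respect to Lebesgue measure. -/
def drivingLaw (γ : ℝ) (N : ℕ) : Measure ℝ :=
  volume.withDensity fun x => ENNReal.ofReal (drivingDensity γ N x)

/-- The numbers `B(j, k)`, for `1 ≤ j ≤ k ≤ n`. -/
def B (γ : ℝ) (p a : ℕ → ℝ) (j k : ℕ) : ℝ :=
  (((∑ i ∈ Finset.Icc j k, p i) * γ * Real.log 2) /
    ∑ i ∈ Finset.Icc j k, a i ^ (γ / (γ - 1))) ^ ((γ - 1) / γ)

/-- `min {B(r + 1, k) : r < k ≤ n}`, for `r < n`. -/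
def minB (γ : ℝ) (p a : ℕ → ℝ) (n r : ℕ) : ℝ :=
  sInf ((fun k => B γ p a (r + 1) k) '' Set.Ioc r n)

/-- The indices `r_l`: `r_0 = 0` and
`r_{l+1} = max {i : r_l < i ≤ n, B(r_l + 1, i) = β_{l+1}}` as long as `r_l < n`. -/
def critIndex (γ : ℝ) (p a : ℕ → ℝ) (n : ℕ) : ℕ → ℕ
  | 0 => 0
  | l + 1 => sSup {i : ℕ | critIndex γ p a n l < i ∧ i ≤ n ∧
      B γ p a (critIndex γ p a n l + 1) i = minB γ p a n (critIndex γ p a n l)}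

/-- The critical parameters `β_l`: `β_0 = 0` and `β_{l+1} = min {B(r_l + 1, k) : r_l < k ≤ n}`
as long as `r_l < n`. -/
def critBeta (γ : ℝ) (p a : ℕ → ℝ) (n : ℕ) : ℕ → ℝ
  | 0 => 0
  | l + 1 => minB γ p a n (critIndex γ p a n l)

end GREM

end

noncomputable section

namespace GREM

/-! The free energy is the value of an entropy-energy problem. The number of paths of length `m`
along which `-ξ` is about `t i * N` at each level `i` is about exp(N ∑_{i ≤ m} (p i log 2 - t i ^ γ
/ γ)). A profile `t` is therefore realised when all these partial entropies are positive, and it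
then contributes ∑ (p i log 2 - t i ^ γ / γ + β a i t i). The optimal profile is t i = (lam i * a i)
^ (1 / (γ - 1)), where `lam i` (`slope`) is the smaller of `β` and the critical parameter of the
block of `i`. The blocks whose critical parameter is below `β` are frozen and carry no entropy in
total; the levels above them behave as if there were no constraint.

Lower bound (`ae_eventually_lt_freeEnergy`): a second moment computation for the number of branches
with profile `t`. The correlations between branches cost only the reciprocals of the expected
numbers of shorter paths, which are exponentially small when the partial entropies are positive.

Upper bound (`ae_eventually_freeEnergy_le`): a first moment bound for the weights θ i = lam i * a i
truncated at level `r`, for every `r`, limits the energies of all paths at once. Write β a i = θ i +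
(β / lam i - 1) θ i. The coefficients of the second part decrease in `i`, so Abel summation bounds
it uniformly over the branches (`partitionFunction_le`), and the first part is summed by the first
moment bound.

At the optimal slopes the two bounds have the same value (`upper_sum_eq`, `lower_sum_eq`), because
each block has zero entropy at its critical parameter (`exists_critical_scheme`). A Lipschitz
estimate in `β` passes from rational `β` to all `β` outside one null set. -/

/-! ### The driving law: exponential moments and tails. -/

/-- The limiting scaled cumulant generating function of the driving law at `θ ≥ 0`: the Legendre
transform of `|t| ^ γ / γ`. -/
def cumulant (γ θ : ℝ) : ℝ := (γ - 1) / γ * θ ^ (γ / (γ - 1))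

lemma cumulant_zero {γ : ℝ} (hγ : 1 < γ) : cumulant γ 0 = 0 := by
  have : γ / (γ - 1) ≠ 0 := (div_pos (by linarith) (by linarith)).ne'
  simp [cumulant, Real.zero_rpow this]

lemma integral_exp_neg_mul_abs_rpow {γ b : ℝ} (hγ : 1 < γ) (hb : 0 < b) :
    ∫ x : ℝ, Real.exp (-b * |x| ^ γ) = 2 * (b ^ (-1 / γ) * (1 / γ * Real.Gamma (1 / γ))) := by
  rw [integral_comp_abs (f := fun x => Real.exp (-b * x ^ γ)),
    integral_exp_neg_mul_rpow (by linarith) hb, Real.Gamma_add_one (by positivity)]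

lemma integrable_exp_neg_mul_abs_rpow {γ b : ℝ} (hγ : 1 < γ) (hb : 0 < b) :
    Integrable fun x : ℝ => Real.exp (-b * |x| ^ γ) := by
  -- The Bochner integral of a nonintegrable function is zero, so a positive value already gives
  -- integrability.
  apply Integrable.of_integral_ne_zero
  rw [integral_exp_neg_mul_abs_rpow hγ hb]
  have := Real.Gamma_pos_of_pos (show 0 < 1 / γ by positivity)
  positivity

lemma drivingDensity_pos {γ : ℝ} (hγ : 1 < γ) {N : ℕ} (hN : 0 < N) (x : ℝ) :
    0 < drivingDensity γ N x := by
  have := Real.Gamma_pos_of_pos (show 0 < 1 / γ by positivity)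
  have : (0 : ℝ) < N := by exact_mod_cast hN
  unfold drivingDensity
  positivity

lemma measurable_drivingDensity (γ : ℝ) (N : ℕ) : Measurable (drivingDensity γ N) := by
  unfold drivingDensity
  fun_prop

/-- Damping the exponent of the driving density by a factor `η` costs `η ^ (-1 / γ)` in mass. -/
lemma integral_damped_density {γ η : ℝ} (hγ : 1 < γ) (hη : 0 < η) {N : ℕ} (hN : 0 < N) :
    ∫ x : ℝ, 1 / (2 * Real.Gamma (1 / γ)) * (γ / N) ^ ((γ - 1) / γ) *
      Real.exp (-(η / (γ * (N : ℝ) ^ (γ - 1))) * |x| ^ γ) = η ^ (-1 / γ) := by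
  have hΓ := Real.Gamma_pos_of_pos (show 0 < 1 / γ by positivity)
  have hN' : (0 : ℝ) < N := by exact_mod_cast hN
  have hγ0 : 0 < γ := by linarith
  rw [integral_const_mul, integral_exp_neg_mul_abs_rpow hγ (by positivity)]
  have e1 : (η / (γ * (N : ℝ) ^ (γ - 1))) ^ (-1 / γ) =
      η ^ (-1 / γ) * (γ ^ (1 / γ) * (N : ℝ) ^ ((γ - 1) / γ)) := by
    rw [Real.div_rpow hη.le (by positivity), Real.mul_rpow hγ0.le (by positivity),
      ← Real.rpow_mul hN'.le, neg_div, Real.rpow_neg hγ0.le,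
      show (γ - 1) * -(1 / γ) = -((γ - 1) / γ) by ring, Real.rpow_neg hN'.le]
    field_simp
  have e2 : (γ / (N : ℝ)) ^ ((γ - 1) / γ) = γ / γ ^ (1 / γ) / (N : ℝ) ^ ((γ - 1) / γ) := by
    rw [Real.div_rpow hγ0.le hN'.le, show (γ - 1) / γ = 1 - 1 / γ by field_simp,
      Real.rpow_sub hγ0, Real.rpow_one]
  rw [e1, e2]
  have : γ ^ (1 / γ) ≠ 0 := by positivity
  have : (N : ℝ) ^ ((γ - 1) / γ) ≠ 0 := by positivity
  field_simp

/-- Young's inequality for c^(1/γ) |x|/N and c^(-1/γ) |θ|. With `c < 1` only a fraction of the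
exponent of the density is spent, and the rest keeps the pointwise bound integrable. -/
lemma young_damped {γ c : ℝ} (hγ : 1 < γ) (hc : 0 < c) (θ x : ℝ) {N : ℕ} (hN : 0 < N) :
    θ * x ≤ c / (γ * (N : ℝ) ^ (γ - 1)) * |x| ^ γ +
      N * (cumulant γ |θ| * c ^ (-(1 / (γ - 1)))) := by
  have hN' : (0 : ℝ) < N := by exact_mod_cast hN
  have hγ0 : 0 < γ := by linarith
  have hγ1 : 0 < γ - 1 := by linarith
  have hconj : γ.HolderConjugate (γ / (γ - 1)) := Real.HolderConjugate.conjExponent hγ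
  have hy := Real.young_inequality_of_nonneg (a := c ^ (1 / γ) * (|x| / N))
    (b := c ^ (-(1 / γ)) * |θ|) (by positivity) (by positivity) hconj
  rw [Real.mul_rpow (by positivity) (by positivity), Real.mul_rpow (by positivity) (by positivity),
    ← Real.rpow_mul hc.le, ← Real.rpow_mul hc.le, Real.div_rpow (abs_nonneg x) hN'.le,
    show 1 / γ * γ = 1 by field_simp, Real.rpow_one,
    show -(1 / γ) * (γ / (γ - 1)) = -(1 / (γ - 1)) by field_simp] at hy
  have h1 : θ * x ≤ N * (c ^ (1 / γ) * (|x| / N) * (c ^ (-(1 / γ)) * |θ|)) := by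
    have : N * (c ^ (1 / γ) * (|x| / N) * (c ^ (-(1 / γ)) * |θ|)) = |θ * x| := by
      have : c ^ (1 / γ) ≠ 0 := by positivity
      rw [Real.rpow_neg hc.le, abs_mul]
      field_simp
    rw [this]
    exact le_abs_self _
  refine h1.trans ((mul_le_mul_of_nonneg_left hy hN'.le).trans_eq ?_)
  have e : (N : ℝ) ^ γ = N ^ (γ - 1) * N := by
    rw [Real.rpow_sub hN', Real.rpow_one]
    field_simp
  rw [e, cumulant]
  have : (N : ℝ) ^ (γ - 1) ≠ 0 := by positivity
  field_simp

lemma integral_drivingLaw {γ : ℝ} (hγ : 1 < γ) {N : ℕ} (hN : 0 < N) (g : ℝ → ℝ) :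
    ∫ x, g x ∂(drivingLaw γ N) = ∫ x, drivingDensity γ N x * g x := by
  rw [drivingLaw, integral_withDensity_eq_integral_toReal_smul
    (measurable_drivingDensity γ N).ennreal_ofReal (by simp)]
  simp [ENNReal.toReal_ofReal (drivingDensity_pos hγ hN _).le]

lemma integrable_drivingLaw_iff {γ : ℝ} (hγ : 1 < γ) {N : ℕ} (hN : 0 < N) {g : ℝ → ℝ} :
    Integrable g (drivingLaw γ N) ↔ Integrable fun x => drivingDensity γ N x * g x := by
  rw [drivingLaw, integrable_withDensity_iff
    (measurable_drivingDensity γ N).ennreal_ofReal (by simp)]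
  simp [ENNReal.toReal_ofReal (drivingDensity_pos hγ hN _).le, mul_comm]

lemma integrable_mgf_drivingLaw_and_le {γ η : ℝ} (hγ : 1 < γ) (hη : 0 < η) (hη1 : η < 1)
    {N : ℕ} (hN : 0 < N) (θ : ℝ) :
    Integrable (fun x => Real.exp (θ * x)) (drivingLaw γ N) ∧
      ∫ x, Real.exp (θ * x) ∂(drivingLaw γ N) ≤
        η ^ (-1 / γ) * Real.exp (N * (cumulant γ |θ| * (1 - η) ^ (-(1 / (γ - 1))))) := by
  have hN' : (0 : ℝ) < N := by exact_mod_cast hN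
  have hΓ := Real.Gamma_pos_of_pos (show 0 < 1 / γ by positivity)
  set E := Real.exp (N * (cumulant γ |θ| * (1 - η) ^ (-(1 / (γ - 1)))))
  have hpt : ∀ x, drivingDensity γ N x * Real.exp (θ * x) ≤
      (1 / (2 * Real.Gamma (1 / γ)) * (γ / N) ^ ((γ - 1) / γ) *
        Real.exp (-(η / (γ * (N : ℝ) ^ (γ - 1))) * |x| ^ γ)) * E := by
    intro x
    rw [drivingDensity, mul_assoc, mul_assoc _ _ E, ← Real.exp_add, ← Real.exp_add]
    refine mul_le_mul_of_nonneg_left (Real.exp_le_exp.2 ?_) (by positivity)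
    have := young_damped hγ (show 0 < 1 - η by linarith) θ x hN
    have e : (1 - η) / (γ * (N : ℝ) ^ (γ - 1)) * |x| ^ γ =
      |x| ^ γ / (γ * (N : ℝ) ^ (γ - 1)) - η / (γ * (N : ℝ) ^ (γ - 1)) * |x| ^ γ := by ring
    rw [e] at this
    linarith
  have hint := ((integrable_exp_neg_mul_abs_rpow hγ
    (show 0 < η / (γ * (N : ℝ) ^ (γ - 1)) by positivity)).const_mul
    (1 / (2 * Real.Gamma (1 / γ)) * (γ / N) ^ ((γ - 1) / γ))).mul_const E
  have hint2 : Integrable fun x => drivingDensity γ N x * Real.exp (θ * x) := by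
    refine hint.mono' ?_ (Eventually.of_forall fun x => ?_)
    · exact ((measurable_drivingDensity γ N).mul (by fun_prop)).aestronglyMeasurable
    · rw [Real.norm_of_nonneg (mul_nonneg (drivingDensity_pos hγ hN x).le (Real.exp_pos _).le)]
      exact hpt x
  refine ⟨(integrable_drivingLaw_iff hγ hN).2 hint2, ?_⟩
  rw [integral_drivingLaw hγ hN]
  refine (integral_mono hint2 hint hpt).trans_eq ?_
  rw [integral_mul_const, integral_damped_density hγ hη hN]

/-- As the damping `η` tends to 0 the exponent tends to the cumulant, so a fixed small `η` costs `ε`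
in the rate and a factor η^(-1/γ) that does not depend on `N`. -/
lemma exists_mgf_drivingLaw_le {γ : ℝ} (hγ : 1 < γ) (θ : ℝ) {ε : ℝ} (hε : 0 < ε) :
    ∃ C : ℝ, 0 < C ∧ ∀ N : ℕ, 0 < N →
      Integrable (fun x => Real.exp (θ * x)) (drivingLaw γ N) ∧
      ∫ x, Real.exp (θ * x) ∂(drivingLaw γ N) ≤ C * Real.exp (N * (cumulant γ |θ| + ε)) := by
  have hcont : Tendsto (fun η : ℝ => cumulant γ |θ| * (1 - η) ^ (-(1 / (γ - 1)))) (𝓝[>] 0)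
      (𝓝 (cumulant γ |θ|)) := by
    have : ContinuousAt (fun η : ℝ => cumulant γ |θ| * (1 - η) ^ (-(1 / (γ - 1)))) 0 := by
      refine continuousAt_const.mul (ContinuousAt.rpow_const (by fun_prop) (Or.inl (by norm_num)))
    have h := this.tendsto
    simp only [sub_zero, Real.one_rpow, mul_one] at h
    exact h.mono_left nhdsWithin_le_nhds
  obtain ⟨η, h1, h2, h3⟩ := ((hcont.eventually (gt_mem_nhds (lt_add_of_pos_right _ hε))).and
    ((eventually_mem_nhdsWithin (a := (0 : ℝ)) (s := Set.Ioi 0)).and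
      (eventually_nhdsWithin_of_eventually_nhds (gt_mem_nhds one_pos)))).exists
  simp only [Set.mem_Ioi] at h2
  refine ⟨η ^ (-1 / γ), by positivity, fun N hN => ?_⟩
  have := integrable_mgf_drivingLaw_and_le hγ h2 h3 hN θ
  exact ⟨this.1, this.2.trans (by gcongr)⟩

/-- The half-line contains a unit interval, on which the density is least at the end farther from
the origin. -/
lemma drivingDensity_le_drivingLaw_Iic {γ t : ℝ} (hγ : 1 < γ) (ht : 0 ≤ t) {N : ℕ} (hN : 0 < N) :
    ENNReal.ofReal (drivingDensity γ N (t * N + 1)) ≤ drivingLaw γ N (Set.Iic (-(t * N))) := by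
  have hN' : (0 : ℝ) < N := by exact_mod_cast hN
  have hΓ := Real.Gamma_pos_of_pos (show 0 < 1 / γ by positivity)
  rw [drivingLaw, withDensity_apply _ measurableSet_Iic]
  calc ENNReal.ofReal (drivingDensity γ N (t * N + 1))
      = ∫⁻ _ in Set.Icc (-(t * N + 1)) (-(t * N)), ENNReal.ofReal (drivingDensity γ N (t * N + 1)) := by
        simp
    _ ≤ ∫⁻ x in Set.Icc (-(t * N + 1)) (-(t * N)), ENNReal.ofReal (drivingDensity γ N x) := by
        refine setLIntegral_mono (measurable_drivingDensity γ N).ennreal_ofReal fun x hx => ?_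
        refine ENNReal.ofReal_le_ofReal ?_
        have : |x| ≤ |t * N + 1| := by
          rw [abs_of_nonneg (show 0 ≤ t * N + 1 by positivity)]
          refine abs_le.2 ⟨hx.1, hx.2.trans ?_⟩
          have : 0 ≤ t * N := by positivity
          linarith
        unfold drivingDensity
        gcongr
    _ ≤ _ := lintegral_mono_set fun x hx => hx.2

/-- Half of `ε` absorbs the unit shift in the argument of the density, the other half its polynomial
prefactor. -/
lemma eventually_exp_le_drivingLaw_Iic {γ t : ℝ} (hγ : 1 < γ) (ht : 0 ≤ t) {ε : ℝ} (hε : 0 < ε) :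
    ∀ᶠ N : ℕ in atTop, ENNReal.ofReal (Real.exp (-(N * (t ^ γ / γ + ε)))) ≤
      drivingLaw γ N (Set.Iic (-(t * N))) := by
  have hΓ := Real.Gamma_pos_of_pos (show 0 < 1 / γ by positivity)
  have hγ0 : 0 < γ := by linarith
  have h1 : Tendsto (fun N : ℕ => 1 / (2 * Real.Gamma (1 / γ)) * γ ^ ((γ - 1) / γ) *
      (Real.exp (ε / 2 * N) / (N : ℝ) ^ ((γ - 1) / γ))) atTop atTop :=
    (((tendsto_exp_mul_div_rpow_atTop ((γ - 1) / γ) (ε / 2) (by positivity)).comp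
      tendsto_natCast_atTop_atTop)).const_mul_atTop (by positivity)
  have h2 : Tendsto (fun N : ℕ => (t + 1 / (N : ℝ)) ^ γ / γ) atTop (𝓝 (t ^ γ / γ)) := by
    have := ((tendsto_const_nhds (x := t)).add tendsto_one_div_atTop_nhds_zero_nat).rpow_const
      (p := γ) (Or.inr hγ0.le)
    simp only [add_zero] at this
    exact this.div_const γ
  filter_upwards [h1.eventually_ge_atTop 1, eventually_gt_atTop 0,
    h2.eventually (gt_mem_nhds (lt_add_of_pos_right _ (half_pos hε)))] with N hN1 hN hN2
  refine le_trans (ENNReal.ofReal_le_ofReal ?_) (drivingDensity_le_drivingLaw_Iic hγ ht hN)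
  have hN' : (0 : ℝ) < N := by exact_mod_cast hN
  have e : |t * N + 1| ^ γ / (γ * (N : ℝ) ^ (γ - 1)) = N * ((t + 1 / (N : ℝ)) ^ γ / γ) := by
    rw [abs_of_nonneg (by positivity), show t * N + 1 = (t + 1 / (N : ℝ)) * N by field_simp,
      Real.mul_rpow (by positivity) hN'.le, Real.rpow_sub hN', Real.rpow_one]
    field_simp
  rw [drivingDensity, e, Real.div_rpow hγ0.le hN'.le]
  calc Real.exp (-(N * (t ^ γ / γ + ε)))
      ≤ 1 * Real.exp (-(ε / 2 * N)) * Real.exp (-(N * ((t + 1 / (N : ℝ)) ^ γ / γ))) := by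
        rw [one_mul, ← Real.exp_add]
        refine Real.exp_le_exp.2 ?_
        have := mul_le_mul_of_nonneg_left hN2.le hN'.le
        linarith
    _ ≤ (1 / (2 * Real.Gamma (1 / γ)) * γ ^ ((γ - 1) / γ) *
      (Real.exp (ε / 2 * N) / (N : ℝ) ^ ((γ - 1) / γ))) * Real.exp (-(ε / 2 * N)) *
        Real.exp (-(N * ((t + 1 / (N : ℝ)) ^ γ / γ))) := by gcongr
    _ = _ := by
        rw [Real.exp_neg (ε / 2 * N)]
        field_simp

lemma drivingLaw_two {N : ℕ} (hN : 0 < N) : drivingLaw 2 N = gaussianReal 0 (N : ℝ≥0) := by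
  have hN' : (0 : ℝ) < N := by exact_mod_cast hN
  rw [gaussianReal_of_var_ne_zero _ (by exact_mod_cast hN.ne'), drivingLaw]
  congr 1
  ext x
  rw [gaussianPDF]
  congr 1
  rw [drivingDensity, gaussianPDFReal, Real.Gamma_one_half_eq]
  norm_num
  rw [← Real.sqrt_eq_rpow, Real.sqrt_div' _ hN'.le]
  congr 1
  · have := Real.sq_sqrt (show (0:ℝ) ≤ 2 by norm_num)
    field_simp
    exact this
  · congr 1
    ring

/-! ### Borel-Cantelli for exponentially small probabilities. -/

section BorelCantelli

variable {Ω : Type*} [MeasurableSpace Ω] {P : Measure Ω}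

lemma ae_eventually_notMem_of_exp_decay {s : ℕ → Set Ω} [IsFiniteMeasure P] {C c : ℝ} (hc : 0 < c)
    (h : ∀ᶠ N : ℕ in atTop, P (s N) ≤ ENNReal.ofReal (C * Real.exp (-(c * N)))) :
    ∀ᵐ ω ∂P, ∀ᶠ N in atTop, ω ∉ s N := by
  obtain ⟨M, hM⟩ := eventually_atTop.1 h
  have hsum : Summable fun N : ℕ => C * Real.exp (-(c * N)) := by
    refine Summable.mul_left C ?_
    have := Real.summable_exp_nat_mul_iff.2 (neg_lt_zero.2 hc)
    refine this.congr fun N => ?_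
    congr 1
    ring
  have key : ∑' N, P (s (N + M)) ≠ ∞ := by
    refine ne_top_of_le_ne_top ?_ (ENNReal.tsum_le_tsum fun N => hM (N + M) (by omega))
    exact ((summable_nat_add_iff M).2 hsum).tsum_ofReal_ne_top
  filter_upwards [ae_eventually_notMem key] with ω hω
  obtain ⟨K, hK⟩ := eventually_atTop.1 hω
  refine eventually_atTop.2 ⟨K + M, fun N hN => ?_⟩
  have := hK (N - M) (by omega)
  rwa [Nat.sub_add_cancel (by omega)] at this

lemma ae_eventually_lt_exp_of_integral_le {X : ℕ → Ω → ℝ} [IsFiniteMeasure P] {C b c : ℝ}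
    (hbc : b < c) (hX : ∀ N ω, 0 ≤ X N ω)
    (h : ∀ᶠ N : ℕ in atTop, Integrable (X N) P ∧ ∫ ω, X N ω ∂P ≤ C * Real.exp (N * b)) :
    ∀ᵐ ω ∂P, ∀ᶠ N : ℕ in atTop, X N ω < Real.exp (N * c) := by
  have := ae_eventually_notMem_of_exp_decay (P := P) (s := fun N => {ω | Real.exp (N * c) ≤ X N ω})
    (C := C) (sub_pos.2 hbc) ?_
  · filter_upwards [this] with ω hω
    filter_upwards [hω] with N hN
    simpa using hN
  · filter_upwards [h] with N hN
    have hm := mul_meas_ge_le_integral_of_nonneg (Eventually.of_forall (hX N)) hN.1 (Real.exp (N * c))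
    rw [← ENNReal.ofReal_toReal (measure_ne_top P {ω | Real.exp (N * c) ≤ X N ω})]
    refine ENNReal.ofReal_le_ofReal ?_
    change P.real _ ≤ _
    have h2 : P.real {ω | Real.exp (N * c) ≤ X N ω} ≤ C * Real.exp (N * b) / Real.exp (N * c) := by
      rw [le_div_iff₀' (Real.exp_pos _)]
      exact hm.trans hN.2
    refine h2.trans_eq ?_
    rw [mul_div_assoc, ← Real.exp_sub]
    congr 2
    ring

end BorelCantelli

/-! ### Combinatorics of the tree. -/

section Tree

variable {k : ℕ → ℕ → ℕ} {n N : ℕ}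

lemma ancestor_injective (σ : Word k N n) : Function.Injective (ancestor σ) :=
  fun _ _ h => congrArg Sigma.fst h

lemma ancestor_eq_iff {σ τ : Word k N n} {i : Fin n} :
    ancestor τ i = ancestor σ i ↔ ∀ j ≤ i, τ j = σ j := by
  constructor
  · intro h j hj
    have h' := eq_of_heq (Sigma.mk.inj h).2
    exact congrFun h' ⟨j, Nat.lt_succ_of_le hj⟩
  · intro h
    unfold ancestor
    congr 1
    funext j
    exact h _ (Nat.le_of_lt_succ j.isLt)

/-- The number of words which agree with `σ` on the first `r` levels. -/
lemma card_agree (σ : Word k N n) (r : ℕ) :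
    (Finset.univ.filter fun τ : Word k N n => ∀ j : Fin n, (j : ℕ) < r → τ j = σ j).card =
      ∏ i : Fin n, if (i : ℕ) < r then 1 else 2 ^ k (i + 1) N := by
  have : (Finset.univ.filter fun τ : Word k N n => ∀ j : Fin n, (j : ℕ) < r → τ j = σ j) =
      Fintype.piFinset fun j : Fin n => if (j : ℕ) < r then {σ j} else Finset.univ := by
    ext τ
    simp only [Finset.mem_filter, Finset.mem_univ, true_and, Fintype.mem_piFinset]
    refine forall_congr' fun j => ?_
    by_cases hj : (j : ℕ) < r <;> simp [hj]
  rw [this, Fintype.card_piFinset]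
  refine Finset.prod_congr rfl fun j _ => ?_
  by_cases hj : (j : ℕ) < r <;> simp [hj]

lemma card_word : Fintype.card (Word k N n) = ∏ i : Fin n, 2 ^ k (i + 1) N := by
  simp [Fintype.card_pi]

lemma sum_Icc_eq_sum_fin {M : Type*} [AddCommMonoid M] (f : ℕ → M) (n : ℕ) :
    ∑ i ∈ Finset.Icc 1 n, f i = ∑ i : Fin n, f (i + 1) := by
  rw [← Finset.sum_range fun i => f (i + 1), Finset.range_eq_Ico, Finset.sum_Ico_add' f 0 n 1]
  rfl

end Tree

/-! ### First moments of the partition function. -/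

section Moments

variable {Ω : Type*} [MeasurableSpace Ω] {P : Measure Ω}
  {γ : ℝ} {n N : ℕ} {k : ℕ → ℕ → ℕ} {X : Node k n N → Ω → ℝ}

lemma integral_exp_branch (hγ : 1 < γ) (hN : 0 < N) (hX : iIndepFun X P)
    (hlaw : ∀ v, HasLaw (X v) (drivingLaw γ N) P) (θ : ℕ → ℝ) (σ : Word k N n) :
    Integrable (fun ω => Real.exp (-1 * hamiltonian θ (fun v => X v ω) σ)) P ∧
    ∫ ω, Real.exp (-1 * hamiltonian θ (fun v => X v ω) σ) ∂P =
      ∏ i : Fin n, ∫ x, Real.exp (-θ (i + 1) * x) ∂(drivingLaw γ N) := by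
  have hpos : ∀ t : ℝ, 0 < ∫ x, Real.exp (t * x) ∂(drivingLaw γ N) := by
    intro t
    obtain ⟨C, -, hC⟩ := exists_mgf_drivingLaw_le hγ t one_pos
    -- Positivity needs only that the law is nonzero, which the tail bound at `t = 0` shows.
    have : NeZero (drivingLaw γ N) := by
      refine ⟨fun h0 => ?_⟩
      have h1 := drivingDensity_le_drivingLaw_Iic hγ le_rfl hN
      rw [h0] at h1
      simp only [Measure.coe_zero, Pi.zero_apply, nonpos_iff_eq_zero, ENNReal.ofReal_eq_zero] at h1
      exact absurd h1 (not_le.2 (drivingDensity_pos hγ hN _))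
    exact integral_exp_pos (hC N hN).1
  have heq : (fun ω => Real.exp (-1 * hamiltonian θ (fun v => X v ω) σ)) =
      fun ω => ∏ i : Fin n, Real.exp (-θ (i + 1) * X (ancestor σ i) ω) := by
    funext ω
    rw [← Real.exp_sum, hamiltonian, Finset.mul_sum]
    simp
  have hval : ∫ ω, Real.exp (-1 * hamiltonian θ (fun v => X v ω) σ) ∂P =
      ∏ i : Fin n, ∫ x, Real.exp (-θ (i + 1) * x) ∂(drivingLaw γ N) := by
    rw [heq, (hX.precomp (ancestor_injective σ)).integral_fun_prod_comp
      (f := fun (i : Fin n) x => Real.exp (-θ (i + 1) * x))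
      (fun i => (hlaw _).aemeasurable) (fun i => by fun_prop)]
    refine Finset.prod_congr rfl fun i _ => ?_
    exact (hlaw (ancestor σ i)).integral_comp (f := fun x => Real.exp (-θ (i + 1) * x))
      (by fun_prop)
  refine ⟨Integrable.of_integral_ne_zero ?_, hval⟩
  rw [hval]
  exact (Finset.prod_pos fun i _ => hpos _).ne'

end Moments

/-- The almost sure first moment bound, for arbitrary weights `θ`. -/
lemma ae_eventually_partitionFunction_lt {Ω : Type*} [MeasurableSpace Ω] {P : Measure Ω}
    [IsProbabilityMeasure P] {γ : ℝ} (hγ : 1 < γ) {n : ℕ} (hn : 1 ≤ n) {k : ℕ → ℕ → ℕ}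
    (hk_sum : ∀ N ≥ n, ∑ i ∈ Finset.Icc 1 n, k i N = N) {ξ : (N : ℕ) → Node k n N → Ω → ℝ}
    (hξ_indep : ∀ N ≥ n, iIndepFun (ξ N) P)
    (hξ_law : ∀ N ≥ n, ∀ v, HasLaw (ξ N v) (drivingLaw γ N) P) (θ : ℕ → ℝ) {ε : ℝ} (hε : 0 < ε) :
    ∀ᵐ ω ∂P, ∀ᶠ N : ℕ in atTop, partitionFunction θ (fun v => ξ N v ω) 1 <
      Real.exp (N * (Real.log 2 + ∑ i : Fin n, cumulant γ |θ (i + 1)| + ε)) := by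
  have hn' : (0 : ℝ) < n := by exact_mod_cast hn
  choose C hC hCb using fun i : Fin n =>
    exists_mgf_drivingLaw_le hγ (-θ (i + 1)) (show 0 < ε / (2 * n) by positivity)
  refine ae_eventually_lt_exp_of_integral_le (C := ∏ i, C i)
    (b := Real.log 2 + ∑ i : Fin n, cumulant γ |θ (i + 1)| + ε / 2) (by linarith)
    (fun N ω => Finset.sum_nonneg fun σ _ => (Real.exp_pos _).le) ?_
  filter_upwards [eventually_ge_atTop n] with N hN
  have hN0 : 0 < N := by omega
  have hb := integral_exp_branch hγ hN0 (hξ_indep N hN) (hξ_law N hN) θ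
  refine ⟨integrable_finsetSum _ fun σ _ => (hb σ).1, ?_⟩
  unfold partitionFunction
  rw [integral_finsetSum _ fun σ _ => (hb σ).1]
  simp_rw [fun σ => (hb σ).2]
  rw [Finset.sum_const, Finset.card_univ, card_word, Finset.prod_pow_eq_pow_sum,
    ← sum_Icc_eq_sum_fin (fun i => k i N), hk_sum N hN, nsmul_eq_mul]
  have h1 : ∏ i : Fin n, ∫ x, Real.exp (-θ (i + 1) * x) ∂(drivingLaw γ N) ≤
      ∏ i : Fin n, C i * Real.exp (N * (cumulant γ |θ (i + 1)| + ε / (2 * n))) := by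
    refine Finset.prod_le_prod (fun i _ => integral_nonneg fun x => (Real.exp_pos _).le)
      fun i _ => ?_
    have := (hCb i N hN0).2
    rwa [abs_neg] at this
  refine (mul_le_mul_of_nonneg_left h1 (by positivity)).trans_eq ?_
  rw [Finset.prod_mul_distrib, ← Real.exp_sum, ← Finset.mul_sum, Finset.sum_add_distrib]
  have h2 : ((2 ^ N : ℕ) : ℝ) = Real.exp (N * Real.log 2) := by
    rw [Real.exp_nat_mul, Real.exp_log two_pos]
    norm_num
  rw [h2, mul_left_comm, ← Real.exp_add]
  congr 2
  simp only [Finset.sum_const, Finset.card_univ, Fintype.card_fin, nsmul_eq_mul]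
  field_simp
  ring

/-! ### Abel summation. -/

section Abel

/-- Keeping the slack of the partial sum, weighted by the latest coefficient, makes the induction
close: the slack is nonnegative, so passing to the next, smaller coefficient only weakens the bound.
-/
lemma sum_range_mul_le_of_partial_sums_le {n : ℕ} {c d : ℕ → ℝ} {δ : ℝ}
    (hc : ∀ i, i + 1 < n → c (i + 1) ≤ c i) (hd : ∀ r ≤ n, ∑ i ∈ Finset.range r, d i ≤ δ) :
    ∀ r < n, ∑ i ∈ Finset.range (r + 1), c i * d i ≤
      c 0 * δ - c r * (δ - ∑ i ∈ Finset.range (r + 1), d i) := by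
  intro r
  induction r with
  | zero => intro _; simp; linarith
  | succ r ih =>
    intro hr
    have h1 := ih (by omega)
    have h2 := mul_nonneg (sub_nonneg.2 (hc r hr)) (sub_nonneg.2 (hd (r + 1) (by omega)))
    rw [Finset.sum_range_succ (n := r + 1), Finset.sum_range_succ d (n := r + 1)]
    linarith

/-- Abel summation: antitone nonnegative weights preserve an upper bound on partial sums. -/
lemma sum_mul_le_of_partial_sums_le {n : ℕ} {c d : Fin n → ℝ} {δ M : ℝ} (hδ : 0 ≤ δ)
    (hM : 0 ≤ M) (hc : Antitone c) (hc0 : ∀ i, 0 ≤ c i) (hcM : ∀ i, c i ≤ M)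
    (hd : ∀ r ≤ n, ∑ i : Fin n, (if (i : ℕ) < r then d i else 0) ≤ δ) :
    ∑ i, c i * d i ≤ M * δ := by
  cases n with
  | zero => simpa using mul_nonneg hM hδ
  | succ m =>
    let c' : ℕ → ℝ := fun i => if h : i < m + 1 then c ⟨i, h⟩ else 0
    let d' : ℕ → ℝ := fun i => if h : i < m + 1 then d ⟨i, h⟩ else 0
    have hc' : ∀ i : Fin (m + 1), c' i = c i := fun i => dif_pos i.isLt
    have hd' : ∀ i : Fin (m + 1), d' i = d i := fun i => dif_pos i.isLt
    have hdr : ∀ r ≤ m + 1, ∑ i ∈ Finset.range r, d' i ≤ δ := by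
      intro r hr
      refine le_trans (le_of_eq ?_) (hd r hr)
      have h1 : ∑ i : Fin (m + 1), (if (i : ℕ) < r then d i else 0) =
          ∑ i ∈ Finset.range (m + 1), if i < r then d' i else 0 := by
        rw [Finset.sum_range]
        simp only [hd']
      rw [h1, ← Finset.sum_filter]
      refine Finset.sum_congr ?_ fun _ _ => rfl
      ext i
      simp only [Finset.mem_range, Finset.mem_filter]
      omega
    have := sum_range_mul_le_of_partial_sums_le (n := m + 1) (c := c') (d := d') (δ := δ)
      (fun i hi => by
        have h1 : i < m + 1 := by omega
        simp only [c', hi, h1, dif_pos]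
        exact hc (by simp [Fin.le_def])) hdr m (by omega)
    rw [Finset.sum_range] at this
    simp only [hc', hd'] at this
    have h0 : c' 0 ≤ M := by simpa [c'] using hcM 0
    have hm : 0 ≤ c' m := by simpa [c'] using hc0 ⟨m, by omega⟩
    have h3 := mul_nonneg hm (sub_nonneg.2 (hdr (m + 1) le_rfl))
    have h4 := mul_le_mul_of_nonneg_right h0 hδ
    linarith

end Abel

/-! ### Deterministic upper bound from truncated partition functions. -/

section Deterministic

variable {k : ℕ → ℕ → ℕ} {n N : ℕ}

/-- The weights `θ`, set to zero above level `r`. -/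
def truncate (θ : ℕ → ℝ) (r i : ℕ) : ℝ := if i ≤ r then θ i else 0

lemma log_two_pow (m : ℕ) : ((2 ^ m : ℕ) : ℝ) = Real.exp (m * Real.log 2) := by
  rw [Real.exp_nat_mul, Real.exp_log two_pos]
  norm_num

lemma card_agree_eq_exp (σ : Word k N n) (r : ℕ) :
    ((Finset.univ.filter fun τ : Word k N n => ∀ j : Fin n, (j : ℕ) < r → τ j = σ j).card : ℝ) =
      Real.exp (∑ i : Fin n, if (i : ℕ) < r then 0 else k (i + 1) N * Real.log 2) := by
  rw [card_agree, Real.exp_sum, Nat.cast_prod]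
  refine Finset.prod_congr rfl fun i _ => ?_
  split_ifs
  · simp
  · exact log_two_pow _

lemma hamiltonian_truncate (θ : ℕ → ℝ) (x : Node k n N → ℝ) (r : ℕ) (σ : Word k N n) :
    -1 * hamiltonian (truncate θ r) x σ =
      ∑ i : Fin n, if (i : ℕ) < r then -(θ (i + 1) * x (ancestor σ i)) else 0 := by
  rw [hamiltonian, Finset.mul_sum]
  refine Finset.sum_congr rfl fun i _ => ?_
  simp only [truncate, Nat.succ_le_iff]
  split_ifs <;> simp

/-- A bound on the truncated partition function bounds the energy of every path of length `r`. -/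
lemma path_le_of_partitionFunction_le {θ : ℕ → ℝ} {x : Node k n N → ℝ} {r : ℕ} {D : ℝ}
    (h : partitionFunction (truncate θ r) x 1 ≤ Real.exp D) (σ : Word k N n) :
    ∑ i : Fin n, (if (i : ℕ) < r then -(θ (i + 1) * x (ancestor σ i)) else 0) ≤
      D - ∑ i : Fin n, if (i : ℕ) < r then 0 else k (i + 1) N * Real.log 2 := by
  rw [le_sub_iff_add_le, ← Real.exp_le_exp]
  refine le_trans ?_ h
  -- All words that agree with `σ` on the first `r` levels have the same truncated energy, so the
  -- sum contains this one weight as many times as there are such words.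
  rw [Real.exp_add, ← card_agree_eq_exp σ r, mul_comm, ← nsmul_eq_mul, ← Finset.sum_const]
  unfold partitionFunction
  refine le_trans (Finset.sum_le_sum fun τ hτ => ?_)
    (Finset.sum_le_univ_sum_of_nonneg fun τ => (Real.exp_pos _).le)
  rw [hamiltonian_truncate]
  refine Real.exp_le_exp.2 (Finset.sum_le_sum fun i _ => ?_)
  split_ifs with hi
  · rw [ancestor_eq_iff.2 fun j hj => (Finset.mem_filter.1 hτ).2 j (lt_of_le_of_lt hj hi)]
  · rfl

/-- The weights β a i split as (1 + c i) θ i with c i = β / lam i - 1. The part `θ` is summed by the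
hypothesis at `r = n`. The excess is bounded on every branch separately: the hypotheses for all `r`
bound the partial sums of -θ i x - g i by N ε, and `c` is antitone because `lam` is monotone. -/
lemma partitionFunction_le {γ : ℝ} {θ lam a : ℕ → ℝ} {β ε : ℝ} {x : Node k n N → ℝ}
    (hε : 0 ≤ ε) (hlam : ∀ i ∈ Finset.Icc 1 n, 0 < lam i ∧ lam i ≤ β)
    (hmono : ∀ i j, 1 ≤ i → i ≤ j → j ≤ n → lam i ≤ lam j)
    (hθ : ∀ i, θ i = lam i * a i) (hksum : ∑ i ∈ Finset.Icc 1 n, k i N = N)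
    (h : ∀ r ≤ n, partitionFunction (truncate θ r) x 1 ≤
      Real.exp (N * (Real.log 2 + ∑ i : Fin n, cumulant γ |truncate θ r (i + 1)| + ε)))
    (hγ : 1 < γ) (hn : 1 ≤ n) :
    partitionFunction a x β ≤ Real.exp (∑ i : Fin n, β / lam (i + 1) *
      (k (i + 1) N * Real.log 2 + N * cumulant γ |θ (i + 1)|) + (β / lam 1 + 1) * (N * ε)) := by
  have hmem : ∀ i : Fin n, (i : ℕ) + 1 ∈ Finset.Icc 1 n := fun i => by
    simp only [Finset.mem_Icc]; omega
  have hk : (N : ℝ) * Real.log 2 = ∑ i : Fin n, k (i + 1) N * Real.log 2 := by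
    rw [← Finset.sum_mul, ← sum_Icc_eq_sum_fin (fun i => (k i N : ℝ)), ← Nat.cast_sum, hksum]
  set g : Fin n → ℝ := fun i => k (i + 1) N * Real.log 2 + N * cumulant γ |θ (i + 1)| with hg
  set c : Fin n → ℝ := fun i => β / lam (i + 1) - 1 with hcdef
  have h1n : (1 : ℕ) ∈ Finset.Icc 1 n := by simp [hn]
  have hβ : 0 < β := (hlam 1 h1n).1.trans_le (hlam 1 h1n).2
  have hM : 0 ≤ β / lam 1 := div_nonneg hβ.le (hlam 1 h1n).1.le
  have hpath : ∀ σ : Word k N n, ∑ i, c i * (-(θ (i + 1) * x (ancestor σ i)) - g i) ≤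
      β / lam 1 * (N * ε) := by
    intro σ
    refine sum_mul_le_of_partial_sums_le (by positivity) hM ?_ ?_ ?_ ?_
    · intro i j hij
      have := hmono (i + 1) (j + 1) (by omega) (by simpa using hij) (by omega)
      have := (hlam _ (hmem i)).1
      simp only [hcdef]
      gcongr
    · intro i
      have := (hlam _ (hmem i))
      simp only [hcdef, sub_nonneg]
      exact (one_le_div this.1).2 this.2
    · intro i
      have h1 := hmono 1 (i + 1) le_rfl (by omega) (by omega)
      have h2 := (hlam 1 h1n).1
      have : β / lam (i + 1) ≤ β / lam 1 := by gcongr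
      simp only [hcdef]
      linarith
    · intro r hr
      have h1 := path_le_of_partitionFunction_le (h r hr) σ
      have h2 : ∑ i : Fin n, (if (i : ℕ) < r then -(θ (i + 1) * x (ancestor σ i)) - g i else 0) =
          ∑ i : Fin n, (if (i : ℕ) < r then -(θ (i + 1) * x (ancestor σ i)) else 0)
          - (∑ i : Fin n, k (i + 1) N * Real.log 2 -
            ∑ i : Fin n, if (i : ℕ) < r then 0 else k (i + 1) N * Real.log 2)
          - N * ∑ i : Fin n, cumulant γ |truncate θ r (i + 1)| := by
        rw [Finset.mul_sum, ← Finset.sum_sub_distrib, ← Finset.sum_sub_distrib,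
          ← Finset.sum_sub_distrib]
        refine Finset.sum_congr rfl fun i _ => ?_
        simp only [truncate, Nat.succ_le_iff, hg]
        split_ifs
        · ring
        · simp [cumulant_zero hγ]
      rw [h2, ← hk]
      linarith
  have hexp : ∀ σ : Word k N n, -β * hamiltonian a x σ =
      -1 * hamiltonian (truncate θ n) x σ +
        (∑ i, c i * (-(θ (i + 1) * x (ancestor σ i)) - g i) + ∑ i, c i * g i) := by
    intro σ
    rw [hamiltonian_truncate, hamiltonian, Finset.mul_sum, ← Finset.sum_add_distrib,
      ← Finset.sum_add_distrib]
    refine Finset.sum_congr rfl fun i _ => ?_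
    have := (hlam _ (hmem i)).1
    simp only [i.isLt, if_true, hcdef, hθ]
    field_simp
    ring
  have htr : ∀ i : Fin n, truncate θ n (i + 1) = θ (i + 1) := fun i => by
    simp [truncate]
  calc partitionFunction a x β
      ≤ ∑ σ : Word k N n, Real.exp (-1 * hamiltonian (truncate θ n) x σ) *
          Real.exp (β / lam 1 * (N * ε) + ∑ i, c i * g i) := by
        unfold partitionFunction
        refine Finset.sum_le_sum fun σ _ => ?_
        rw [← Real.exp_add, hexp]
        have := hpath σ
        gcongr
    _ = partitionFunction (truncate θ n) x 1 *
          Real.exp (β / lam 1 * (N * ε) + ∑ i, c i * g i) := by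
        rw [partitionFunction, Finset.sum_mul]
    _ ≤ Real.exp (N * (Real.log 2 + ∑ i : Fin n, cumulant γ |truncate θ n (i + 1)| + ε)) *
          Real.exp (β / lam 1 * (N * ε) + ∑ i, c i * g i) := by
        gcongr
        exact h n le_rfl
    _ = _ := by
        rw [← Real.exp_add]
        congr 1
        simp only [htr]
        rw [mul_add, mul_add, hk, Finset.mul_sum]
        have : ∑ i : Fin n, β / lam (i + 1) * g i = ∑ i, c i * g i + ∑ i, g i := by
          rw [← Finset.sum_add_distrib]
          refine Finset.sum_congr rfl fun i _ => ?_
          simp only [hcdef]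
          ring
        rw [this]
        simp only [hg, Finset.sum_add_distrib]
        ring

end Deterministic

/-! ### Almost sure upper bound, and dependence on the inverse temperature. -/

section AlmostSure

variable {Ω : Type*} [MeasurableSpace Ω] {P : Measure Ω} [IsProbabilityMeasure P]
  {γ : ℝ} {n : ℕ} {k : ℕ → ℕ → ℕ} {p : ℕ → ℝ} {ξ : (N : ℕ) → Node k n N → Ω → ℝ}

lemma partitionFunction_pos {N : ℕ} (a : ℕ → ℝ) (x : Node k n N → ℝ) (β : ℝ) :
    0 < partitionFunction a x β :=
  Finset.sum_pos (fun _ _ => Real.exp_pos _) Finset.univ_nonempty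

/-- The upper bound on the free energy. -/
lemma ae_eventually_freeEnergy_le (hγ : 1 < γ) (hn : 1 ≤ n)
    (hk_sum : ∀ N ≥ n, ∑ i ∈ Finset.Icc 1 n, k i N = N)
    (hp : ∀ i ∈ Finset.Icc 1 n, Tendsto (fun N : ℕ => (k i N : ℝ) / N) atTop (𝓝 (p i)))
    (hξ_indep : ∀ N ≥ n, iIndepFun (ξ N) P)
    (hξ_law : ∀ N ≥ n, ∀ v, HasLaw (ξ N v) (drivingLaw γ N) P)
    {a lam : ℕ → ℝ} {β : ℝ} (ha : ∀ i ∈ Finset.Icc 1 n, 0 < a i)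
    (hlam : ∀ i ∈ Finset.Icc 1 n, 0 < lam i ∧ lam i ≤ β)
    (hmono : ∀ i j, 1 ≤ i → i ≤ j → j ≤ n → lam i ≤ lam j) {ε : ℝ} (hε : 0 < ε) :
    ∀ᵐ ω ∂P, ∀ᶠ N : ℕ in atTop,
      1 / (N : ℝ) * Real.log (partitionFunction a (fun v => ξ N v ω) β) <
        ∑ i ∈ Finset.Icc 1 n, β / lam i * (p i * Real.log 2 + cumulant γ (lam i * a i)) + ε := by
  have h1n : (1 : ℕ) ∈ Finset.Icc 1 n := by simp [hn]
  have hβ : 0 < β := (hlam 1 h1n).1.trans_le (hlam 1 h1n).2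
  have hM : 0 ≤ β / lam 1 := div_nonneg hβ.le (hlam 1 h1n).1.le
  set θ : ℕ → ℝ := fun i => lam i * a i
  -- The deterministic bound multiplies the error by `β / lam 1 + 1`, so this leaves `ε / 2` for the
  -- convergence of the proportions `k i N / N`.
  set δ := ε / 2 / (β / lam 1 + 1)
  have hδ : 0 < δ := by positivity
  have hall := ae_all_iff.2 fun r : ℕ =>
    ae_eventually_partitionFunction_lt hγ hn hk_sum hξ_indep hξ_law (truncate θ r) hδ
  have hlim : Tendsto (fun N : ℕ => ∑ i ∈ Finset.Icc 1 n, β / lam i *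
      ((k i N : ℝ) / N * Real.log 2 + cumulant γ (lam i * a i))) atTop
      (𝓝 (∑ i ∈ Finset.Icc 1 n, β / lam i * (p i * Real.log 2 + cumulant γ (lam i * a i)))) :=
    tendsto_finsetSum _ fun i hi => (((hp i hi).mul_const _).add_const _).const_mul _
  filter_upwards [hall] with ω hω
  have hω' : ∀ᶠ N : ℕ in atTop, ∀ r ∈ Finset.range (n + 1), _ :=
    (Finset.eventually_all _).2 fun r _ => hω r
  filter_upwards [hω', eventually_ge_atTop n,
    hlim.eventually (gt_mem_nhds (lt_add_of_pos_right _ (half_pos hε)))] with N hN hNn hNl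
  have hN0 : (0 : ℝ) < N := by exact_mod_cast (show 0 < N by omega)
  have := partitionFunction_le (γ := γ) (θ := θ) (lam := lam) (a := a) hδ.le hlam hmono
    (fun _ => rfl) (hk_sum N hNn)
    (fun r hr => (hN r (Finset.mem_range.2 (by omega))).le) hγ hn
  have h2 := (Real.log_le_iff_le_exp (partitionFunction_pos _ _ _)).2 this
  rw [one_div, inv_mul_lt_iff₀ hN0]
  refine h2.trans_lt ?_
  rw [← sum_Icc_eq_sum_fin fun i => β / lam i * (k i N * Real.log 2 + N * cumulant γ |θ i|)]
  have h3 : ∑ i ∈ Finset.Icc 1 n, β / lam i * (k i N * Real.log 2 + N * cumulant γ |θ i|) =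
      N * ∑ i ∈ Finset.Icc 1 n, β / lam i *
        ((k i N : ℝ) / N * Real.log 2 + cumulant γ (lam i * a i)) := by
    rw [Finset.mul_sum]
    refine Finset.sum_congr rfl fun i hi => ?_
    have : |θ i| = lam i * a i := abs_of_pos (mul_pos (hlam i hi).1 (ha i hi))
    rw [this]
    have := (hlam i hi).1
    field_simp
  have h4 : (β / lam 1 + 1) * (N * δ) = N * (ε / 2) := by
    simp only [δ]
    field_simp
  rw [h3, h4, ← mul_add]
  exact mul_lt_mul_of_pos_left (by linarith) hN0

/-- Energies are almost surely of order `N`. -/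
lemma ae_exists_abs_hamiltonian_le (hγ : 1 < γ) (hn : 1 ≤ n)
    (hk_sum : ∀ N ≥ n, ∑ i ∈ Finset.Icc 1 n, k i N = N)
    (hξ_indep : ∀ N ≥ n, iIndepFun (ξ N) P)
    (hξ_law : ∀ N ≥ n, ∀ v, HasLaw (ξ N v) (drivingLaw γ N) P) (a : ℕ → ℝ) :
    ∃ C : ℝ, ∀ᵐ ω ∂P, ∀ᶠ N : ℕ in atTop, ∀ σ : Word k N n,
      |hamiltonian a (fun v => ξ N v ω) σ| ≤ N * C := by
  -- A single summand is at most the whole partition function; the weights `a` and `-a` bound the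
  -- energy from below and from above.
  have h1 := ae_eventually_partitionFunction_lt hγ hn hk_sum hξ_indep hξ_law a one_pos
  have h2 := ae_eventually_partitionFunction_lt hγ hn hk_sum hξ_indep hξ_law (-a) one_pos
  refine ⟨Real.log 2 + ∑ i : Fin n, cumulant γ |a (i + 1)| + 1, ?_⟩
  filter_upwards [h1, h2] with ω hω1 hω2
  filter_upwards [hω1, hω2] with N hN1 hN2 σ
  have key : ∀ b : ℕ → ℝ, Real.exp (-1 * hamiltonian b (fun v => ξ N v ω) σ) ≤
      partitionFunction b (fun v => ξ N v ω) 1 := fun b =>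
    Finset.single_le_sum (f := fun τ => Real.exp (-1 * hamiltonian b (fun v => ξ N v ω) τ))
      (fun τ _ => (Real.exp_pos _).le) (Finset.mem_univ σ)
  have hneg : hamiltonian (-a) (fun v => ξ N v ω) σ = -hamiltonian a (fun v => ξ N v ω) σ := by
    simp [hamiltonian]
  have g1 := Real.exp_le_exp.1 ((key a).trans hN1.le)
  have g2 := Real.exp_le_exp.1 ((key (-a)).trans hN2.le)
  rw [hneg] at g2
  simp only [Pi.neg_apply, abs_neg] at g2
  refine abs_le.2 ⟨by linarith, by linarith⟩

lemma log_partitionFunction_le_add {N : ℕ} {a : ℕ → ℝ} {x : Node k n N → ℝ} {C β β' : ℝ}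
    (h : ∀ σ, |hamiltonian a x σ| ≤ C) :
    Real.log (partitionFunction a x β) ≤
      Real.log (partitionFunction a x β') + |β - β'| * C := by
  rw [Real.log_le_iff_le_exp (partitionFunction_pos _ _ _), Real.exp_add,
    Real.exp_log (partitionFunction_pos _ _ _)]
  unfold partitionFunction
  rw [Finset.sum_mul]
  refine Finset.sum_le_sum fun σ _ => ?_
  rw [← Real.exp_add]
  refine Real.exp_le_exp.2 ?_
  have h1 : (β' - β) * hamiltonian a x σ ≤ |β - β'| * C := by
    refine (le_abs_self _).trans ?_
    rw [abs_mul, abs_sub_comm]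
    exact mul_le_mul_of_nonneg_left (h σ) (abs_nonneg _)
  linarith

end AlmostSure

/-! ### Second moment of the number of branches with prescribed energies. -/

/-- The second moment method for the number of events of a finite family which occur. -/
lemma measureReal_sum_indicator_le {Ω ι : Type*} [Fintype ι] [MeasurableSpace Ω] {P : Measure Ω}
    [IsProbabilityMeasure P] {A : ι → Set Ω} (hA : ∀ σ, NullMeasurableSet (A σ) P) {M s : ℝ}
    (hM : 0 < M) (h1 : ∑ σ, P.real (A σ) = M)
    (h2 : ∑ σ, ∑ τ, P.real (A σ ∩ A τ) ≤ M ^ 2 * (1 + s)) :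
    P {ω | ∑ σ, (A σ).indicator (fun _ => (1 : ℝ)) ω ≤ M / 2} ≤ ENNReal.ofReal (4 * s) := by
  set Y : Ω → ℝ := fun ω => ∑ σ, (A σ).indicator (fun _ => (1 : ℝ)) ω with hY
  have hmem : ∀ B : Set Ω, NullMeasurableSet B P →
      MemLp (B.indicator fun _ => (1 : ℝ)) 2 P := fun B hB =>
    MemLp.of_bound ((aestronglyMeasurable_indicator_iff₀ hB).2 aestronglyMeasurable_const) 1
      (Eventually.of_forall fun ω => by
        by_cases h : ω ∈ B <;> simp [h])
  have hint : ∀ B : Set Ω, NullMeasurableSet B P →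
      ∫ ω, B.indicator (fun _ => (1 : ℝ)) ω ∂P = P.real B := fun B hB => by
    rw [integral_indicator₀ hB]
    simp
  have hYmem : MemLp Y 2 P := memLp_finsetSum _ fun σ _ => hmem _ (hA σ)
  have hEY : ∫ ω, Y ω ∂P = M := by
    rw [integral_finsetSum _ fun σ _ => (hmem _ (hA σ)).integrable (by norm_num), ← h1]
    exact Finset.sum_congr rfl fun σ _ => hint _ (hA σ)
  have hEY2 : ∫ ω, (Y ^ 2) ω ∂P = ∑ σ, ∑ τ, P.real (A σ ∩ A τ) := by
    have : Y ^ 2 = fun ω => ∑ σ, ∑ τ, (A σ ∩ A τ).indicator (fun _ => (1 : ℝ)) ω := by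
      funext ω
      rw [Pi.pow_apply, sq, hY]
      simp only []
      rw [Finset.sum_mul_sum]
      refine Finset.sum_congr rfl fun σ _ => Finset.sum_congr rfl fun τ _ => ?_
      by_cases h : ω ∈ A σ <;> by_cases h' : ω ∈ A τ <;> simp [h, h']
    have hi : ∀ σ τ, Integrable (fun ω => (A σ ∩ A τ).indicator (fun _ => (1 : ℝ)) ω) P :=
      fun σ τ => (hmem _ ((hA σ).inter (hA τ))).integrable (by norm_num)
    rw [this, integral_finsetSum _ fun σ _ => integrable_finsetSum _ fun τ _ => hi σ τ]
    refine Finset.sum_congr rfl fun σ _ => ?_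
    rw [integral_finsetSum _ fun τ _ => hi σ τ]
    exact Finset.sum_congr rfl fun τ _ => hint _ ((hA σ).inter (hA τ))
  -- The variance is at most s M², and a deviation of M / 2 is needed, whence the factor 4.
  have hcheb := meas_ge_le_variance_div_sq hYmem (half_pos hM)
  rw [variance_eq_sub hYmem] at hcheb
  simp only [hEY, hEY2] at hcheb
  refine (measure_mono fun ω hω => ?_).trans (hcheb.trans (ENNReal.ofReal_le_ofReal ?_))
  · simp only [Set.mem_ofPred_eq] at hω ⊢
    rw [abs_sub_comm]
    refine le_trans ?_ (le_abs_self _)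
    change M / 2 ≤ M - ∑ σ, (A σ).indicator (fun _ => (1 : ℝ)) ω
    linarith
  · rw [div_le_iff₀ (by positivity)]
    nlinarith

section SecondMoment

variable {k : ℕ → ℕ → ℕ} {n N : ℕ}

open Classical in
/-- The sum over all words of the weights of the nodes at which they have left `σ`. -/
lemma sum_prod_disagree_le (q : Fin n → ℝ) (hq : ∀ i, 0 ≤ q i) (σ : Word k N n) :
    ∑ τ : Word k N n, ∏ i : Fin n, (if ancestor τ i = ancestor σ i then 1 else q i) ≤
      ∑ m ∈ Finset.range (n + 1),
        ∏ i : Fin n, if (i : ℕ) < m then 1 else 2 ^ k (i + 1) N * q i := by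
  have hw : ∀ τ : Word k N n,
      ∏ i : Fin n, (if ancestor τ i = ancestor σ i then 1 else q i) ≤
      ∑ m ∈ Finset.range (n + 1), if ∀ j : Fin n, (j : ℕ) < m → τ j = σ j then
        ∏ i : Fin n, (if (i : ℕ) < m then 1 else q i) else 0 := by
    intro τ
    -- The product for `τ` is exactly the summand for the largest `m` with `Q m`, the length of the
    -- common prefix; the other summands are nonnegative.
    let Q : ℕ → Prop := fun m => ∀ j : Fin n, (j : ℕ) < m → τ j = σ j
    have hQ : Q (Nat.findGreatest Q n) :=
      Nat.findGreatest_spec (P := Q) (Nat.zero_le n) fun j hj => absurd hj (Nat.not_lt_zero _)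
    have hle := Nat.findGreatest_le (P := Q) n
    have hterm : ∏ i : Fin n, (if ancestor τ i = ancestor σ i then 1 else q i) =
        if Q (Nat.findGreatest Q n) then
          ∏ i : Fin n, (if (i : ℕ) < Nat.findGreatest Q n then 1 else q i) else 0 := by
      rw [if_pos hQ]
      refine Finset.prod_congr rfl fun i _ => ?_
      refine if_congr ?_ rfl rfl
      rw [ancestor_eq_iff]
      constructor
      · intro h
        have : Q ((i : ℕ) + 1) := fun j hj => h j (Nat.le_of_lt_succ hj)
        exact Nat.le_findGreatest (P := Q) (by omega) this
      · exact fun h j hj => hQ j (lt_of_le_of_lt hj h)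
    rw [hterm]
    refine Finset.single_le_sum (f := fun m => if Q m then
      ∏ i : Fin n, (if (i : ℕ) < m then 1 else q i) else 0) (fun m _ => ?_)
      (Finset.mem_range.2 (by omega))
    split_ifs
    · exact Finset.prod_nonneg fun i _ => by split_ifs <;> simp [hq]
    · rfl
  refine (Finset.sum_le_sum fun τ _ => hw τ).trans_eq ?_
  rw [Finset.sum_comm]
  refine Finset.sum_congr rfl fun m _ => ?_
  rw [← Finset.sum_filter, Finset.sum_const, nsmul_eq_mul]
  have hc := card_agree σ m
  rw [show (Finset.univ.filter fun τ : Word k N n => ∀ j : Fin n, (j : ℕ) < m → τ j = σ j).card =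
    ∏ i : Fin n, if (i : ℕ) < m then 1 else 2 ^ k (i + 1) N from by convert hc]
  rw [Nat.cast_prod, ← Finset.prod_mul_distrib]
  refine Finset.prod_congr rfl fun i _ => ?_
  split_ifs <;> simp

lemma prod_above_eq (g : Fin n → ℝ) (hg : ∀ i, 0 < g i) (m : ℕ) :
    ∏ i : Fin n, (if (i : ℕ) < m then 1 else g i) =
      (∏ i, g i) * (∏ i : Fin n, if (i : ℕ) < m then g i else 1)⁻¹ := by
  have h0 : ∏ i : Fin n, (if (i : ℕ) < m then g i else 1) ≠ 0 :=
    Finset.prod_ne_zero_iff.2 fun i _ => by split_ifs <;> simp [(hg i).ne']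
  rw [eq_mul_inv_iff_mul_eq₀ h0, ← Finset.prod_mul_distrib]
  refine Finset.prod_congr rfl fun i _ => ?_
  split_ifs <;> simp

variable {Ω : Type*} [MeasurableSpace Ω] {P : Measure Ω} {X : Node k n N → Ω → ℝ}

/-- The event that the variables along the branch `σ` take values in prescribed sets. -/
def branchEvent (X : Node k n N → Ω → ℝ) (s : Fin n → Set ℝ) (σ : Word k N n) : Set Ω :=
  ⋂ i, X (ancestor σ i) ⁻¹' s i

lemma nullMeasurableSet_branchEvent (hX : ∀ v, AEMeasurable (X v) P) {s : Fin n → Set ℝ}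
    (hs : ∀ i, MeasurableSet (s i)) (σ : Word k N n) :
    NullMeasurableSet (branchEvent X s σ) P :=
  NullMeasurableSet.iInter fun i => (hX _).nullMeasurableSet_preimage (hs i)

-- The joint event concerns the nodes of `σ` (the set `S`) and those nodes of `τ` that are not on
-- `σ` (the set `T`). They are distinct, so independence gives a product in which shared nodes count
-- once.
open Classical in
lemma measureReal_branchEvent_inter (hX : iIndepFun X P) {s : Fin n → Set ℝ}
    (hs : ∀ i, MeasurableSet (s i)) {q : Fin n → ℝ}
    (hq : ∀ i w, P.real (X ⟨i, w⟩ ⁻¹' s i) = q i) (σ τ : Word k N n) :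
    P.real (branchEvent X s σ ∩ branchEvent X s τ) =
      (∏ i, q i) * ∏ i : Fin n, if ancestor τ i = ancestor σ i then 1 else q i := by
  set S : Finset (Node k n N) := Finset.univ.image (ancestor σ)
  set T : Finset (Node k n N) :=
    (Finset.univ.filter fun i => ancestor τ i ≠ ancestor σ i).image (ancestor τ)
  have hdisj : Disjoint S T := by
    rw [Finset.disjoint_left]
    rintro v hv hv'
    obtain ⟨i, -, rfl⟩ := Finset.mem_image.1 hv
    obtain ⟨j, hj, hji⟩ := Finset.mem_image.1 hv'
    have hij : j = i := congrArg Sigma.fst hji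
    subst hij
    exact (Finset.mem_filter.1 hj).2 hji
  have hset : branchEvent X s σ ∩ branchEvent X s τ = ⋂ v ∈ S ∪ T, X v ⁻¹' s v.1 := by
    ext ω
    simp only [branchEvent, Set.mem_inter_iff, Set.mem_iInter, Finset.mem_union]
    constructor
    · rintro ⟨h1, h2⟩ v (hv | hv)
      · obtain ⟨i, -, rfl⟩ := Finset.mem_image.1 hv
        exact h1 i
      · obtain ⟨i, -, rfl⟩ := Finset.mem_image.1 hv
        exact h2 i
    · refine fun h => ⟨fun i => h _ (Or.inl (Finset.mem_image_of_mem _ (Finset.mem_univ _))),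
        fun i => ?_⟩
      by_cases hi : ancestor τ i = ancestor σ i
      · rw [hi]
        exact h _ (Or.inl (Finset.mem_image_of_mem _ (Finset.mem_univ _)))
      · exact h _ (Or.inr (Finset.mem_image_of_mem _ (Finset.mem_filter.2 ⟨Finset.mem_univ _, hi⟩)))
  have hqv : ∀ v : Node k n N, P.real (X v ⁻¹' s v.1) = q v.1 := fun ⟨i, w⟩ => hq i w
  rw [hset, measureReal_def, hX.measure_inter_preimage_eq_mul (S ∪ T) (fun v _ => hs v.1),
    ENNReal.toReal_prod]
  have : ∀ v, (P (X v ⁻¹' s v.1)).toReal = q v.1 := hqv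
  simp only [this]
  rw [Finset.prod_union hdisj, Finset.prod_image (ancestor_injective σ).injOn,
    Finset.prod_image (ancestor_injective τ).injOn, Finset.prod_filter]
  congr 1
  refine Finset.prod_congr rfl fun i _ => ?_
  by_cases hi : ancestor τ i = ancestor σ i
  · simp [hi]
  · simp only [ne_eq, hi, not_false_eq_true, if_true, if_false]
    rfl

/-- The number of branches along which all variables lie in prescribed sets is at least half its
expectation, except on an event whose probability is controlled by the reciprocals of the expected
numbers of such paths. -/
lemma measure_count_branchEvent_le [IsProbabilityMeasure P] (hX : iIndepFun X P)
    (hm : ∀ v, AEMeasurable (X v) P) {s : Fin n → Set ℝ}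
    (hs : ∀ i, MeasurableSet (s i)) {q : Fin n → ℝ} (hq0 : ∀ i, 0 < q i)
    (hq : ∀ i w, P.real (X ⟨i, w⟩ ⁻¹' s i) = q i) :
    P {ω | ∑ σ, (branchEvent X s σ).indicator (fun _ => (1 : ℝ)) ω ≤
        (∏ i : Fin n, 2 ^ k (i + 1) N * q i) / 2} ≤
      ENNReal.ofReal (4 * ∑ m ∈ Finset.range n,
        (∏ i : Fin n, if (i : ℕ) < m + 1 then 2 ^ k (i + 1) N * q i else 1)⁻¹) := by
  classical
  have hg : ∀ i : Fin n, 0 < 2 ^ k (i + 1) N * q i := fun i => mul_pos (by positivity) (hq0 i)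
  have hcard : ∀ c : ℝ, ∑ _σ : Word k N n, c = (∏ i : Fin n, 2 ^ k (i + 1) N) * c := fun c => by
    rw [Finset.sum_const, Finset.card_univ, card_word]
    simp
  refine measureReal_sum_indicator_le (nullMeasurableSet_branchEvent hm hs)
    (Finset.prod_pos fun i _ => hg i) ?_ ?_
  · have : ∀ σ, P.real (branchEvent X s σ) = ∏ i, q i := fun σ => by
      have := measureReal_branchEvent_inter hX hs hq σ σ
      simpa using this
    simp only [this]
    rw [hcard, Finset.prod_mul_distrib]
  · calc ∑ σ, ∑ τ, P.real (branchEvent X s σ ∩ branchEvent X s τ)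
        ≤ ∑ σ : Word k N n, (∏ i, q i) * ∑ m ∈ Finset.range (n + 1),
            ∏ i : Fin n, (if (i : ℕ) < m then 1 else 2 ^ k (i + 1) N * q i) := by
          refine Finset.sum_le_sum fun σ _ => ?_
          simp only [measureReal_branchEvent_inter hX hs hq]
          rw [← Finset.mul_sum]
          refine mul_le_mul_of_nonneg_left ?_ (Finset.prod_nonneg fun i _ => (hq0 i).le)
          exact sum_prod_disagree_le q (fun i => (hq0 i).le) σ
      _ = _ := by
          -- The term `m = 0`, of empty common prefix, gives the squared mean; each other term is
          -- the squared mean divided by the expected number of paths as long as the common prefix.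
          rw [hcard, ← mul_assoc, ← Finset.prod_mul_distrib, Finset.sum_range_succ', sq, mul_assoc]
          congr 1
          simp only [prod_above_eq _ hg, ← Finset.mul_sum]
          simp
          ring

end SecondMoment

/-! ### Almost sure lower bound for a given energy profile. -/

lemma count_mul_exp_le_partitionFunction {Ω : Type*} {n : ℕ} {k : ℕ → ℕ → ℕ}
    {ξ : (N : ℕ) → Node k n N → Ω → ℝ} {N : ℕ} {a t : ℕ → ℝ} {β : ℝ} (hβ : 0 ≤ β)
    (ha : ∀ i ∈ Finset.Icc 1 n, 0 < a i) (ω : Ω) :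
    (∑ σ, (branchEvent (ξ N) (fun i => Set.Iic (-(t (i + 1) * N))) σ).indicator
      (fun _ => (1 : ℝ)) ω) * Real.exp (N * ∑ i ∈ Finset.Icc 1 n, β * a i * t i) ≤
      partitionFunction a (fun v => ξ N v ω) β := by
  rw [partitionFunction, Finset.sum_mul]
  refine Finset.sum_le_sum fun σ _ => ?_
  by_cases h : ω ∈ branchEvent (ξ N) (fun i => Set.Iic (-(t (i + 1) * N))) σ
  · rw [Set.indicator_of_mem h, one_mul, Real.exp_le_exp, sum_Icc_eq_sum_fin, hamiltonian,
      Finset.mul_sum, Finset.mul_sum]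
    refine Finset.sum_le_sum fun i _ => ?_
    have h1 : ξ N (ancestor σ i) ω ≤ -(t (i + 1) * N) := Set.mem_iInter.1 h i
    have h2 : 0 ≤ β * a (i + 1) :=
      mul_nonneg hβ (ha _ (by simp only [Finset.mem_Icc]; omega)).le
    have := mul_le_mul_of_nonneg_left h1 h2
    linarith
  · rw [Set.indicator_of_notMem h, zero_mul]
    exact (Real.exp_pos _).le

section AlmostSure

variable {Ω : Type*} [MeasurableSpace Ω] {P : Measure Ω} [IsProbabilityMeasure P]
  {γ : ℝ} {n : ℕ} {k : ℕ → ℕ → ℕ} {p : ℕ → ℝ} {ξ : (N : ℕ) → Node k n N → Ω → ℝ}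

lemma sum_Icc_eq_sum_fin_ite (f : ℕ → ℝ) {m : ℕ} (hm : m ≤ n) :
    ∑ i ∈ Finset.Icc 1 m, f i = ∑ i : Fin n, if (i : ℕ) < m then f (i + 1) else 0 := by
  have h := sum_Icc_eq_sum_fin (fun i => if i ≤ m then f i else 0) n
  simp only [Nat.succ_le_iff] at h
  rw [← h, ← Finset.sum_filter]
  refine Finset.sum_congr ?_ fun _ _ => rfl
  ext i
  simp only [Finset.mem_Icc, Finset.mem_filter]
  omega

/-- The lower bound on the free energy, from the branches with energies `t`. -/
lemma ae_eventually_lt_freeEnergy (hγ : 1 < γ) (hn : 1 ≤ n)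
    (hp : ∀ i ∈ Finset.Icc 1 n, Tendsto (fun N : ℕ => (k i N : ℝ) / N) atTop (𝓝 (p i)))
    (hξ_indep : ∀ N ≥ n, iIndepFun (ξ N) P)
    (hξ_law : ∀ N ≥ n, ∀ v, HasLaw (ξ N v) (drivingLaw γ N) P)
    {a t : ℕ → ℝ} {β : ℝ} (hβ : 0 ≤ β) (ha : ∀ i ∈ Finset.Icc 1 n, 0 < a i)
    (ht : ∀ i ∈ Finset.Icc 1 n, 0 ≤ t i)
    (hent : ∀ m ∈ Finset.Icc 1 n, 0 < ∑ i ∈ Finset.Icc 1 m, (p i * Real.log 2 - t i ^ γ / γ))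
    {ε : ℝ} (hε : 0 < ε) :
    ∀ᵐ ω ∂P, ∀ᶠ N : ℕ in atTop,
      ∑ i ∈ Finset.Icc 1 n, (p i * Real.log 2 - t i ^ γ / γ + β * a i * t i) - ε <
        1 / (N : ℝ) * Real.log (partitionFunction a (fun v => ξ N v ω) β) := by
  have hn' : (0 : ℝ) < n := by exact_mod_cast hn
  have hmem : ∀ i : Fin n, (i : ℕ) + 1 ∈ Finset.Icc 1 n := fun i => by
    simp only [Finset.mem_Icc]; omega
  obtain ⟨c, hc, hcle⟩ : ∃ c > 0, ∀ m ∈ Finset.Icc 1 n,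
      c ≤ ∑ i ∈ Finset.Icc 1 m, (p i * Real.log 2 - t i ^ γ / γ) := by
    obtain ⟨m, hm, hmin⟩ := Finset.exists_min_image (Finset.Icc 1 n)
      (fun m => ∑ i ∈ Finset.Icc 1 m, (p i * Real.log 2 - t i ^ γ / γ)) ⟨1, by simp [hn]⟩
    exact ⟨_, hent m hm, hmin⟩
  -- The losses add up to `2 * (n * δ)`, at most `c / 2` and `ε / 2`. What is left of `c` is the
  -- decay rate for Borel-Cantelli; what is left of `ε` absorbs the factor 1/2 in the count.
  set δ := min (c / (4 * n)) (ε / (4 * n))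
  have hδ : 0 < δ := lt_min (by positivity) (by positivity)
  have hδc : n * δ ≤ c / 4 := by
    calc n * δ ≤ n * (c / (4 * n)) := by gcongr; exact min_le_left _ _
      _ = c / 4 := by field_simp
  have hδε : n * δ ≤ ε / 4 := by
    calc n * δ ≤ n * (ε / (4 * n)) := by gcongr; exact min_le_right _ _
      _ = ε / 4 := by field_simp
  set q : ℕ → Fin n → ℝ := fun N i => (drivingLaw γ N).real (Set.Iic (-(t (i + 1) * N)))
  have hqlow : ∀ᶠ N : ℕ in atTop, ∀ i : Fin n,
      Real.exp (-(N * (t (i + 1) ^ γ / γ + δ))) ≤ q N i := by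
    refine eventually_all.2 fun i => ?_
    filter_upwards [eventually_exp_le_drivingLaw_Iic hγ (ht _ (hmem i)) hδ,
      eventually_ge_atTop n] with N hN hNn
    -- That the density has mass one is inherited from the law of the variable at any one node.
    have : IsProbabilityMeasure (drivingLaw γ N) :=
      ((hξ_law N hNn ⟨i, fun _ _ => false⟩).isProbabilityMeasure_iff).1 inferInstance
    exact (ENNReal.ofReal_le_iff_le_toReal (measure_ne_top _ _)).1 hN
  have hprod : ∀ᶠ N : ℕ in atTop, ∀ m ∈ Finset.Icc 1 n,
      Real.exp (N * (∑ i ∈ Finset.Icc 1 m, (p i * Real.log 2 - t i ^ γ / γ) - 2 * (n * δ))) ≤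
      ∏ i : Fin n, if (i : ℕ) < m then 2 ^ k (i + 1) N * q N i else 1 := by
    have hlim : ∀ᶠ N : ℕ in atTop, ∀ i ∈ Finset.Icc 1 n,
        p i * Real.log 2 - δ < (k i N : ℝ) / N * Real.log 2 :=
      (Finset.eventually_all _).2 fun i hi =>
        ((hp i hi).mul_const (Real.log 2)).eventually (lt_mem_nhds (sub_lt_self _ hδ))
    filter_upwards [hqlow, hlim, eventually_gt_atTop 0] with N hN hNl hN0 m hm
    have hN' : (0 : ℝ) < N := by exact_mod_cast hN0
    rw [sum_Icc_eq_sum_fin_ite _ (Finset.mem_Icc.1 hm).2]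
    calc Real.exp (N * (∑ i : Fin n, (if (i : ℕ) < m then
            p (i + 1) * Real.log 2 - t (i + 1) ^ γ / γ else 0) - 2 * (n * δ)))
        = ∏ i : Fin n, Real.exp (N * ((if (i : ℕ) < m then
            p (i + 1) * Real.log 2 - t (i + 1) ^ γ / γ else 0) - 2 * δ)) := by
          rw [← Real.exp_sum, ← Finset.mul_sum, Finset.sum_sub_distrib]
          simp only [Finset.sum_const, Finset.card_univ, Fintype.card_fin, nsmul_eq_mul]
          congr 1
          ring
      _ ≤ _ := by
          refine Finset.prod_le_prod (fun i _ => (Real.exp_pos _).le) fun i _ => ?_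
          split_ifs
          · have h2 := log_two_pow (k (i + 1) N)
            push_cast at h2
            rw [h2]
            refine le_trans ?_ (mul_le_mul_of_nonneg_left (hN i) (Real.exp_pos _).le)
            rw [← Real.exp_add, Real.exp_le_exp]
            have h3 := mul_le_mul_of_nonneg_left (hNl _ (hmem i)).le hN'.le
            have h4 : N * ((k (i + 1) N : ℝ) / N * Real.log 2) = k (i + 1) N * Real.log 2 := by
              field_simp
            rw [h4] at h3
            linarith
          · rw [← Real.exp_zero, Real.exp_le_exp]
            have : 0 < N * δ := by positivity
            linarith
  have hBC := ae_eventually_notMem_of_exp_decay (P := P) (C := 4 * n) (half_pos hc)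
    (s := fun N => {ω | ∑ σ, (branchEvent (ξ N) (fun i => Set.Iic (-(t (i + 1) * N))) σ).indicator
      (fun _ => (1 : ℝ)) ω ≤ (∏ i : Fin n, 2 ^ k (i + 1) N * q N i) / 2}) (by
    filter_upwards [hqlow, hprod, eventually_ge_atTop n] with N hNq hN hNn
    refine (measure_count_branchEvent_le (hξ_indep N hNn) (fun v => (hξ_law N hNn v).aemeasurable)
      (fun i => measurableSet_Iic) (q := q N) (fun i => (Real.exp_pos _).trans_le (hNq i))
      fun i w => ?_).trans (ENNReal.ofReal_le_ofReal ?_)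
    · exact (hξ_law N hNn ⟨i, w⟩).measureReal_eq (p := fun x => x ∈ Set.Iic (-(t (i + 1) * N)))
        measurableSet_Iic
    · rw [mul_assoc]
      refine mul_le_mul_of_nonneg_left ?_ (by norm_num)
      refine (Finset.sum_le_card_nsmul _ _ (Real.exp (-(c / 2 * N))) fun m hm => ?_).trans_eq
        (by simp)
      have hm' : m + 1 ∈ Finset.Icc 1 n := by
        simp only [Finset.mem_range] at hm
        simp only [Finset.mem_Icc]
        omega
      rw [Real.exp_neg]
      refine inv_anti₀ (Real.exp_pos _) (le_trans (Real.exp_le_exp.2 ?_) (hN _ hm'))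
      rw [mul_comm]
      have := hcle _ hm'
      gcongr
      linarith)
  have hlarge : ∀ᶠ N : ℕ in atTop, Real.log 2 < N * (ε / 2) :=
    (tendsto_natCast_atTop_atTop.atTop_mul_const (half_pos hε)).eventually_gt_atTop _
  filter_upwards [hBC] with ω hω
  filter_upwards [hω, hprod, hlarge, eventually_gt_atTop 0] with N hN hNp hNl hN0
  have hN' : (0 : ℝ) < N := by exact_mod_cast hN0
  simp only [not_le] at hN
  have h1 := count_mul_exp_le_partitionFunction (ξ := ξ) (t := t) (N := N) hβ ha ω
  have h2 := hNp n (by simp [hn])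
  simp only [Fin.is_lt, if_true] at h2
  set W := ∑ i ∈ Finset.Icc 1 n, (p i * Real.log 2 - t i ^ γ / γ)
  have h3 : Real.exp (N * (W - 2 * (n * δ)) - Real.log 2 +
      N * ∑ i ∈ Finset.Icc 1 n, β * a i * t i) ≤ partitionFunction a (fun v => ξ N v ω) β := by
    refine le_trans ?_ h1
    rw [Real.exp_add, Real.exp_sub, Real.exp_log two_pos]
    gcongr
    linarith
  have h4 := (Real.le_log_iff_exp_le (partitionFunction_pos _ _ _)).2 h3
  rw [one_div, lt_inv_mul_iff₀ hN']
  refine lt_of_lt_of_le ?_ h4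
  rw [Finset.sum_add_distrib]
  have h5 := mul_le_mul_of_nonneg_left hδε hN'.le
  rw [mul_sub, mul_add, mul_sub]
  linarith

end AlmostSure

/-! ### The critical indices and parameters. -/

section Critical

variable {γ : ℝ} {n : ℕ} {p a : ℕ → ℝ}

lemma sum_Icc_add_sum_Icc {M : Type*} [AddCommMonoid M] (f : ℕ → M) {i j l : ℕ} (hij : i ≤ j + 1)
    (hjl : j ≤ l) :
    ∑ x ∈ Finset.Icc i j, f x + ∑ x ∈ Finset.Icc (j + 1) l, f x = ∑ x ∈ Finset.Icc i l, f x := by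
  simp only [← Finset.Ico_add_one_right_eq_Icc]
  exact Finset.sum_Ico_consecutive f hij (by omega)

lemma sum_rpow_Icc_pos (ha : ∀ i ∈ Finset.Icc 1 n, 0 < a i) (s : ℝ) {j m : ℕ} (hj : 1 ≤ j)
    (hjm : j ≤ m) (hm : m ≤ n) : 0 < ∑ i ∈ Finset.Icc j m, a i ^ s := by
  refine Finset.sum_pos (fun i hi => Real.rpow_pos_of_pos (ha i ?_) _) ⟨j, by simp [hjm]⟩
  simp only [Finset.mem_Icc] at hi ⊢
  omega

lemma sum_Icc_nonneg (hp : ∀ i ∈ Finset.Icc 1 n, 0 ≤ p i) {j m : ℕ} (hj : 1 ≤ j) (hm : m ≤ n) :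
    0 ≤ ∑ i ∈ Finset.Icc j m, p i := by
  refine Finset.sum_nonneg fun i hi => hp i ?_
  simp only [Finset.mem_Icc] at hi ⊢
  omega

variable (hγ : 1 < γ) (ha : ∀ i ∈ Finset.Icc 1 n, 0 < a i) (hp : ∀ i ∈ Finset.Icc 1 n, 0 ≤ p i)

include hγ ha hp

lemma B_nonneg_and_rpow {j m : ℕ} (hj : 1 ≤ j) (hjm : j ≤ m) (hm : m ≤ n) :
    0 ≤ B γ p a j m ∧ B γ p a j m ^ (γ / (γ - 1)) =
      ((∑ i ∈ Finset.Icc j m, p i) * γ * Real.log 2) /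
        ∑ i ∈ Finset.Icc j m, a i ^ (γ / (γ - 1)) := by
  have hA := sum_rpow_Icc_pos ha (γ / (γ - 1)) hj hjm hm
  have hP := sum_Icc_nonneg hp hj hm
  have h0 : 0 ≤ ((∑ i ∈ Finset.Icc j m, p i) * γ * Real.log 2) /
      ∑ i ∈ Finset.Icc j m, a i ^ (γ / (γ - 1)) := by
    have := Real.log_nonneg one_le_two
    positivity
  refine ⟨Real.rpow_nonneg h0 _, ?_⟩
  have h1 : γ - 1 ≠ 0 := by linarith
  have h2 : γ ≠ 0 := by linarith
  rw [B, ← Real.rpow_mul h0, show (γ - 1) / γ * (γ / (γ - 1)) = 1 by field_simp, Real.rpow_one]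

/-- Without root and quotient, comparison with `B` is linear in sums over intervals of levels, so
that inequalities for adjacent intervals can be added and subtracted. -/
lemma le_B_iff {x : ℝ} (hx : 0 ≤ x) {j m : ℕ} (hj : 1 ≤ j) (hjm : j ≤ m) (hm : m ≤ n) :
    x ≤ B γ p a j m ↔ x ^ (γ / (γ - 1)) * ∑ i ∈ Finset.Icc j m, a i ^ (γ / (γ - 1)) ≤
      (∑ i ∈ Finset.Icc j m, p i) * γ * Real.log 2 := by
  obtain ⟨h1, h2⟩ := B_nonneg_and_rpow hγ ha hp hj hjm hm
  rw [← Real.rpow_le_rpow_iff hx h1 (div_pos (by linarith) (by linarith) : 0 < γ / (γ - 1)), h2,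
    le_div_iff₀ (sum_rpow_Icc_pos ha _ hj hjm hm)]

lemma lt_B_iff {x : ℝ} (hx : 0 ≤ x) {j m : ℕ} (hj : 1 ≤ j) (hjm : j ≤ m) (hm : m ≤ n) :
    x < B γ p a j m ↔ x ^ (γ / (γ - 1)) * ∑ i ∈ Finset.Icc j m, a i ^ (γ / (γ - 1)) <
      (∑ i ∈ Finset.Icc j m, p i) * γ * Real.log 2 := by
  obtain ⟨h1, h2⟩ := B_nonneg_and_rpow hγ ha hp hj hjm hm
  rw [← Real.rpow_lt_rpow_iff hx h1 (div_pos (by linarith) (by linarith) : 0 < γ / (γ - 1)), h2,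
    lt_div_iff₀ (sum_rpow_Icc_pos ha _ hj hjm hm)]

omit hγ ha hp in
lemma exists_minB_eq {r : ℕ} (hr : r < n) :
    (∃ i, r < i ∧ i ≤ n ∧ B γ p a (r + 1) i = minB γ p a n r) ∧
      ∀ i, r < i → i ≤ n → minB γ p a n r ≤ B γ p a (r + 1) i := by
  have hfin : ((fun k => B γ p a (r + 1) k) '' Set.Ioc r n).Finite := (Set.finite_Ioc r n).image _
  have hne : ((fun k => B γ p a (r + 1) k) '' Set.Ioc r n).Nonempty := ⟨_, n, ⟨hr, le_rfl⟩, rfl⟩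
  constructor
  · obtain ⟨i, hi, h⟩ := hne.csInf_mem hfin
    exact ⟨i, hi.1, hi.2, h⟩
  · exact fun i h1 h2 => csInf_le hfin.bddBelow ⟨i, ⟨h1, h2⟩, rfl⟩

-- Supremum and infimum are attained, the sets being nonempty and finite. The final strict
-- inequality comes from taking the largest minimiser; it is what makes the critical parameters
-- strictly increase.
omit hγ ha hp in
lemma critIndex_succ_spec {l : ℕ} (hl : critIndex γ p a n l < n) :
    critIndex γ p a n l < critIndex γ p a n (l + 1) ∧ critIndex γ p a n (l + 1) ≤ n ∧
    B γ p a (critIndex γ p a n l + 1) (critIndex γ p a n (l + 1)) = critBeta γ p a n (l + 1) ∧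
    (∀ i, critIndex γ p a n l < i → i ≤ n →
      critBeta γ p a n (l + 1) ≤ B γ p a (critIndex γ p a n l + 1) i) ∧
    ∀ i, critIndex γ p a n (l + 1) < i → i ≤ n →
      critBeta γ p a n (l + 1) < B γ p a (critIndex γ p a n l + 1) i := by
  obtain ⟨hex, hle⟩ := exists_minB_eq (γ := γ) (p := p) (a := a) hl
  set S := {i : ℕ | critIndex γ p a n l < i ∧ i ≤ n ∧
      B γ p a (critIndex γ p a n l + 1) i = minB γ p a n (critIndex γ p a n l)} with hS
  have hr : critIndex γ p a n (l + 1) = sSup S := rfl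
  have hbdd : BddAbove S := ⟨n, fun i hi => hi.2.1⟩
  have hmem : sSup S ∈ S := Nat.sSup_mem hex hbdd
  rw [hr]
  refine ⟨hmem.1, hmem.2.1, hmem.2.2, hle, fun i hi hin => ?_⟩
  have h1 : critIndex γ p a n l < i := lt_trans hmem.1 hi
  refine lt_of_le_of_ne (hle i h1 hin) fun h => ?_
  exact absurd (le_csSup hbdd (show i ∈ S from ⟨h1, hin, h.symm⟩)) (not_le.2 hi)

/-- The critical indices and parameters form a finite, strictly increasing scheme, for which the
blocks between consecutive indices have zero entropy at their critical parameter. -/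
lemma exists_critical_scheme (hn : 1 ≤ n) (hp1 : 0 < p 1) :
    ∃ K : ℕ, 1 ≤ K ∧ K ≤ n ∧ critIndex γ p a n K = n ∧
      (∀ l < K, critIndex γ p a n l < critIndex γ p a n (l + 1)) ∧
      (∀ l < K, critBeta γ p a n l < critBeta γ p a n (l + 1)) ∧
      (∀ l < K, critBeta γ p a n (l + 1) ^ (γ / (γ - 1)) *
        ∑ i ∈ Finset.Icc (critIndex γ p a n l + 1) (critIndex γ p a n (l + 1)), a i ^ (γ / (γ - 1))
        = (∑ i ∈ Finset.Icc (critIndex γ p a n l + 1) (critIndex γ p a n (l + 1)), p i) * γ *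
          Real.log 2) ∧
      (∀ l < K, ∀ m, critIndex γ p a n l < m → m ≤ n → critBeta γ p a n (l + 1) ^ (γ / (γ - 1)) *
        ∑ i ∈ Finset.Icc (critIndex γ p a n l + 1) m, a i ^ (γ / (γ - 1))
        ≤ (∑ i ∈ Finset.Icc (critIndex γ p a n l + 1) m, p i) * γ * Real.log 2) := by
  classical
  have hex : ∃ l, n ≤ critIndex γ p a n l := by
    by_contra! h
    have : ∀ l, l ≤ critIndex γ p a n l := by
      intro l
      induction l with
      | zero => exact Nat.zero_le _
      | succ l ih => exact lt_of_le_of_lt ih (critIndex_succ_spec (h l)).1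
    exact absurd (this n) (not_le.2 (h n))
  -- The first index at which the recursion reaches `n`. At the next one `sSup` is taken over the
  -- empty set and the recursion falls back to 0, so the statements are restricted to `l < K`.
  set K := Nat.find hex with hK
  have hlt : ∀ l < K, critIndex γ p a n l < n := fun l hl => not_le.1 (Nat.find_min hex hl)
  have hstep := fun l hl => critIndex_succ_spec (hlt l hl)
  have hind : ∀ l ≤ K, l ≤ critIndex γ p a n l ∧ critIndex γ p a n l ≤ n := by
    intro l
    induction l with
    | zero => exact fun _ => ⟨Nat.zero_le _, Nat.zero_le _⟩
    | succ l ih => exact fun hl => ⟨lt_of_le_of_lt (ih (by omega)).1 (hstep l hl).1,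
        (hstep l hl).2.1⟩
  have hKn : critIndex γ p a n K = n := le_antisymm (hind K le_rfl).2 (Nat.find_spec hex)
  have hK1 : 1 ≤ K := by
    by_contra! h
    have : K = 0 := by omega
    rw [this] at hKn
    change 0 = n at hKn
    omega
  have hnn : ∀ l < K, 0 ≤ critBeta γ p a n (l + 1) := fun l hl => by
    rw [← (hstep l hl).2.2.1]
    exact (B_nonneg_and_rpow hγ ha hp (by omega) (hstep l hl).1 (hstep l hl).2.1).1
  have heq : ∀ l < K, critBeta γ p a n (l + 1) ^ (γ / (γ - 1)) *
        ∑ i ∈ Finset.Icc (critIndex γ p a n l + 1) (critIndex γ p a n (l + 1)), a i ^ (γ / (γ - 1))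
        = (∑ i ∈ Finset.Icc (critIndex γ p a n l + 1) (critIndex γ p a n (l + 1)), p i) * γ *
          Real.log 2 := fun l hl => by
    rw [← (hstep l hl).2.2.1, (B_nonneg_and_rpow hγ ha hp (by omega) (hstep l hl).1
      (hstep l hl).2.1).2, div_mul_cancel₀]
    exact (sum_rpow_Icc_pos ha _ (by omega) (hstep l hl).1 (hstep l hl).2.1).ne'
  refine ⟨K, hK1, hKn ▸ (hind K le_rfl).1, hKn, fun l hl => (hstep l hl).1, ?_, heq,
    fun l hl m hm hmn => (le_B_iff hγ ha hp (hnn l hl) (by omega) hm hmn).1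
      ((hstep l hl).2.2.2.1 m hm hmn)⟩
  intro l hl
  cases l with
  | zero =>
    rw [← (hstep 0 hl).2.2.1]
    have h1 := (hstep 0 hl).1
    have h2 := (hstep 0 hl).2.1
    change 0 < B γ p a (0 + 1) (critIndex γ p a n 1)
    change 0 < critIndex γ p a n 1 at h1
    rw [lt_B_iff hγ ha hp le_rfl (by omega) h1 h2, Real.zero_rpow, zero_mul]
    · change critIndex γ p a n 1 ≤ n at h2
      -- The first block contains level 1, and `p 1 > 0` makes the first critical parameter
      -- positive.
      have : 0 < ∑ i ∈ Finset.Icc (0 + 1) (critIndex γ p a n (0 + 1)), p i := by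
        refine Finset.sum_pos' (fun i hi => hp i ?_) ⟨1, ?_, hp1⟩
        · obtain ⟨g1, g2⟩ := Finset.mem_Icc.1 hi
          exact Finset.mem_Icc.2 ⟨g1, g2.trans h2⟩
        · exact Finset.mem_Icc.2 ⟨le_rfl, h1⟩
      have := Real.log_pos one_lt_two
      positivity
    · exact (div_pos (by linarith) (by linarith)).ne'
  | succ l =>
    have hl' : l < K := by omega
    obtain ⟨h1, h2, h3, h4, h5⟩ := hstep l hl'
    obtain ⟨g1, g2, g3, g4, g5⟩ := hstep (l + 1) hl
    rw [← g3, lt_B_iff hγ ha hp (hnn l hl') (by omega) g1 g2]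
    -- Strict inequality for two consecutive blocks together, minus equality on the first of them,
    -- leaves the strict inequality on the second.
    have k1 := (lt_B_iff hγ ha hp (hnn l hl') (by omega) (by omega) g2).1 (h5 _ g1 g2)
    have k2 := heq l hl'
    rw [← sum_Icc_add_sum_Icc (fun i => a i ^ (γ / (γ - 1)))
      (show critIndex γ p a n l + 1 ≤ critIndex γ p a n (l + 1) + 1 by omega) g1.le,
      ← sum_Icc_add_sum_Icc p
      (show critIndex γ p a n l + 1 ≤ critIndex γ p a n (l + 1) + 1 by omega) g1.le] at k1
    linarith

end Critical

/-! ### The optimal slopes and the value of both bounds. -/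

section Scheme

/-- The block of `i`: the least `l` with `i ≤ r l`. -/
def level (r : ℕ → ℕ) (i : ℕ) : ℕ := sInf {l | i ≤ r l}

/-- The optimal slope at level `i` of the tree: `b l` on the `l`-th block, but at most `β`. -/
def slope (r : ℕ → ℕ) (b : ℕ → ℝ) (β : ℝ) (i : ℕ) : ℝ := min (b (level r i)) β

/-- The free energy, in the phase in which exactly the first `j` blocks are frozen. -/
def phaseFreeEnergy (γ : ℝ) (p a : ℕ → ℝ) (n : ℕ) (r : ℕ → ℕ) (b : ℕ → ℝ) (j : ℕ) (β : ℝ) : ℝ :=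
  ∑ i ∈ Finset.Icc (r j + 1) n, p i * Real.log 2
    + (γ - 1) / γ * ∑ i ∈ Finset.Icc (r j + 1) n, (β * a i) ^ (γ / (γ - 1))
    + β * ∑ l ∈ Finset.Icc 1 j, b l ^ (1 / (γ - 1)) *
      ∑ i ∈ Finset.Icc (r (l - 1) + 1) (r l), a i ^ (γ / (γ - 1))

variable {γ : ℝ} {n K : ℕ} {p a : ℕ → ℝ} {r : ℕ → ℕ} {b : ℕ → ℝ}

lemma le_of_forall_lt_succ {α : Type*} [Preorder α] {f : ℕ → α} {K : ℕ}
    (h : ∀ l < K, f l < f (l + 1)) {i j : ℕ} (hij : i ≤ j) (hj : j ≤ K) : f i ≤ f j := by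
  induction j, hij using Nat.le_induction with
  | base => rfl
  | succ j hij ih => exact (ih (by omega)).trans (h j hj).le

lemma level_eq (hr : ∀ l < K, r l < r (l + 1)) {l i : ℕ} (hl : l < K)
    (hi : i ∈ Finset.Icc (r l + 1) (r (l + 1))) : level r i = l + 1 := by
  obtain ⟨h1, h2⟩ := Finset.mem_Icc.1 hi
  refine le_antisymm (Nat.sInf_le h2) ?_
  by_contra! h
  have hmem : i ≤ r (level r i) := Nat.sInf_mem (s := {l | i ≤ r l}) ⟨l + 1, h2⟩
  have := le_of_forall_lt_succ hr (show level r i ≤ l by omega) hl.le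
  omega

lemma lt_level (hr : ∀ l < K, r l < r (l + 1)) (hrK : r K = n) {j i : ℕ} (hj : j ≤ K)
    (hi : r j < i) (hin : i ≤ n) : j < level r i := by
  by_contra! h
  have hmem : i ≤ r (level r i) :=
    Nat.sInf_mem (s := {l | i ≤ r l}) ⟨K, show i ≤ r K by omega⟩
  have := le_of_forall_lt_succ hr h hj
  omega

lemma level_le (hrK : r K = n) {i : ℕ} (hin : i ≤ n) : level r i ≤ K :=
  Nat.sInf_le (show i ≤ r K by omega)

lemma level_mono (hrK : r K = n) {i j : ℕ} (hij : i ≤ j) (hj : j ≤ n) : level r i ≤ level r j :=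
  csInf_le_csInf' ⟨K, show j ≤ r K by omega⟩ fun _ hl => le_trans hij hl

variable (hr0 : r 0 = 0) (hrK : r K = n) (hr : ∀ l < K, r l < r (l + 1)) (hb0 : b 0 = 0)
  (hb : ∀ l < K, b l < b (l + 1))

include hr0 hrK hr hb0 hb

lemma slope_pos_and_le {β : ℝ} (hβ : 0 < β) {i : ℕ} (hi : i ∈ Finset.Icc 1 n) :
    0 < slope r b β i ∧ slope r b β i ≤ β := by
  obtain ⟨h1, h2⟩ := Finset.mem_Icc.1 hi
  refine ⟨lt_min ?_ hβ, min_le_right _ _⟩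
  have hl := lt_level hr hrK (Nat.zero_le K) (show r 0 < i by omega) h2
  have h3 := le_of_forall_lt_succ hb (show 1 ≤ level r i from hl) (level_le hrK h2)
  have h4 := hb 0 (lt_of_lt_of_le hl (level_le hrK h2))
  rw [hb0] at h4
  exact lt_of_lt_of_le h4 h3

omit hr0 hr hb0 in
lemma slope_mono (β : ℝ) {i j : ℕ} (hij : i ≤ j) (hj : j ≤ n) :
    slope r b β i ≤ slope r b β j :=
  min_le_min (le_of_forall_lt_succ hb (level_mono hrK hij hj) (level_le hrK hj)) le_rfl

-- The condition on `b (j + 1)` is asked only for `j < K`; with `j = K` it is void, and the fully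
-- frozen phase is treated together with the others.
omit hr0 hb0 in
lemma slope_eq_of_lt {β : ℝ} {j i : ℕ} (hj : j ≤ K) (hβj : j < K → β ≤ b (j + 1)) (hi : r j < i)
    (hin : i ≤ n) : slope r b β i = β := by
  have h1 := lt_level hr hrK hj hi hin
  have h2 := level_le hrK hin
  exact min_eq_right ((hβj (by omega)).trans (le_of_forall_lt_succ hb h1 h2))

omit hr0 hrK hb0 in
lemma slope_eq_of_mem {β : ℝ} {j l i : ℕ} (hj : j ≤ K) (hβj : b j < β) (hl : l < j)
    (hi : i ∈ Finset.Icc (r l + 1) (r (l + 1))) : slope r b β i = b (l + 1) := by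
  rw [slope, level_eq hr (by omega) hi]
  exact min_eq_left ((le_of_forall_lt_succ hb hl hj).trans hβj.le)

omit hrK hb0 hb in
lemma sum_Icc_eq_sum_blocks (f : ℕ → ℝ) {j : ℕ} (hj : j ≤ K) :
    ∑ i ∈ Finset.Icc 1 (r j), f i =
      ∑ l ∈ Finset.Icc 1 j, ∑ i ∈ Finset.Icc (r (l - 1) + 1) (r l), f i := by
  induction j with
  | zero => simp [hr0]
  | succ j ih =>
    rw [Finset.sum_Icc_succ_top (by omega), ← ih (by omega), Nat.add_sub_cancel]
    exact (sum_Icc_add_sum_Icc f (by omega) (hr j hj).le).symm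

omit hb0 hb in
/-- A sum over the levels, with known block sums below `r j` and `β`-dependent terms above. -/
lemma sum_eq_phaseFreeEnergy {β : ℝ} {j : ℕ} (hj : j ≤ K) {f : ℕ → ℝ}
    (habove : ∀ i, r j < i → i ≤ n →
      f i = p i * Real.log 2 + (γ - 1) / γ * (β * a i) ^ (γ / (γ - 1)))
    (hblock : ∀ l < j, ∑ i ∈ Finset.Icc (r l + 1) (r (l + 1)), f i =
      β * (b (l + 1) ^ (1 / (γ - 1)) *
        ∑ i ∈ Finset.Icc (r l + 1) (r (l + 1)), a i ^ (γ / (γ - 1)))) :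
    ∑ i ∈ Finset.Icc 1 n, f i = phaseFreeEnergy γ p a n r b j β := by
  have hjn : r j ≤ n := hrK ▸ le_of_forall_lt_succ hr hj le_rfl
  rw [← sum_Icc_add_sum_Icc f (show 1 ≤ r j + 1 by omega) hjn,
    sum_Icc_eq_sum_blocks hr0 hr f hj, phaseFreeEnergy, add_comm]
  congr 1
  · rw [Finset.mul_sum, ← Finset.sum_add_distrib]
    refine Finset.sum_congr rfl fun i hi => ?_
    obtain ⟨h1, h2⟩ := Finset.mem_Icc.1 hi
    exact habove i h1 h2
  · rw [Finset.mul_sum]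
    refine Finset.sum_congr rfl fun l hl => ?_
    obtain ⟨h1, h2⟩ := Finset.mem_Icc.1 hl
    obtain ⟨l, rfl⟩ := Nat.exists_eq_add_of_le' h1
    exact hblock l (by omega)

variable (hγ : 1 < γ) (ha : ∀ i ∈ Finset.Icc 1 n, 0 < a i)

include hγ ha

omit hr0 hb0 hb hγ in
lemma pos_of_mem_block {l i : ℕ} (hl : l < K) (hi : i ∈ Finset.Icc (r l + 1) (r (l + 1))) :
    0 < a i := by
  obtain ⟨h1, h2⟩ := Finset.mem_Icc.1 hi
  have := le_of_forall_lt_succ hr (show l + 1 ≤ K from hl) le_rfl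
  exact ha i (Finset.mem_Icc.2 ⟨by omega, by omega⟩)

/-- On a frozen block with slope `c`, `heq` turns the sum of p i log 2 into the fraction 1/γ of
c^(γ/(γ-1)) ∑ a i^(γ/(γ-1)), and the cumulants supply the fraction (γ-1)/γ. -/
lemma upper_sum_eq {β : ℝ} {j : ℕ} (hj : j ≤ K) (hβ : 0 < β) (hβj : b j < β)
    (hβj' : j < K → β ≤ b (j + 1))
    (heq : ∀ l < K, b (l + 1) ^ (γ / (γ - 1)) *
        ∑ i ∈ Finset.Icc (r l + 1) (r (l + 1)), a i ^ (γ / (γ - 1))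
        = (∑ i ∈ Finset.Icc (r l + 1) (r (l + 1)), p i) * γ * Real.log 2) :
    ∑ i ∈ Finset.Icc 1 n, β / slope r b β i *
      (p i * Real.log 2 + cumulant γ (slope r b β i * a i)) = phaseFreeEnergy γ p a n r b j β := by
  refine sum_eq_phaseFreeEnergy hr0 hrK hr hj ?_ ?_
  · intro i hi hin
    rw [slope_eq_of_lt hrK hr hb hj hβj' hi hin, div_self hβ.ne', one_mul, cumulant]
  · intro l hl
    have hlK : l < K := by omega
    have hbl : 0 < b (l + 1) := by
      have := le_of_forall_lt_succ hb (Nat.zero_le l) hlK.le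
      have := hb l hlK
      linarith
    set c := b (l + 1)
    have h1 : ∑ i ∈ Finset.Icc (r l + 1) (r (l + 1)), β / slope r b β i *
        (p i * Real.log 2 + cumulant γ (slope r b β i * a i)) =
        ∑ i ∈ Finset.Icc (r l + 1) (r (l + 1)), (β / c * Real.log 2 * p i +
          β / c * ((γ - 1) / γ) * c ^ (γ / (γ - 1)) * a i ^ (γ / (γ - 1))) := by
      refine Finset.sum_congr rfl fun i hi => ?_
      rw [slope_eq_of_mem hr hb hj hβj hl hi, cumulant, Real.mul_rpow hbl.le
        (pos_of_mem_block hrK hr ha hlK hi).le]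
      ring
    rw [h1, Finset.sum_add_distrib, ← Finset.mul_sum, ← Finset.mul_sum]
    have h2 := heq l hlK
    have h3 : c ^ (γ / (γ - 1)) = c * c ^ (1 / (γ - 1)) := by
      rw [show γ / (γ - 1) = 1 + 1 / (γ - 1) by field_simp [(by linarith : γ - 1 ≠ 0)]; ring,
        Real.rpow_add hbl, Real.rpow_one]
    have h4 : Real.log 2 * ∑ i ∈ Finset.Icc (r l + 1) (r (l + 1)), p i =
      c ^ (γ / (γ - 1)) * (∑ i ∈ Finset.Icc (r l + 1) (r (l + 1)), a i ^ (γ / (γ - 1))) / γ := by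
      rw [h2]
      field_simp
    rw [mul_assoc (β / c), h4, h3]
    field_simp
    ring

/-- On a frozen block the entropy sums to zero by `heq`, and only the energy remains. -/
lemma lower_sum_eq {β : ℝ} {j : ℕ} (hj : j ≤ K) (hβ : 0 < β) (hβj : b j < β)
    (hβj' : j < K → β ≤ b (j + 1))
    (heq : ∀ l < K, b (l + 1) ^ (γ / (γ - 1)) *
        ∑ i ∈ Finset.Icc (r l + 1) (r (l + 1)), a i ^ (γ / (γ - 1))
        = (∑ i ∈ Finset.Icc (r l + 1) (r (l + 1)), p i) * γ * Real.log 2) :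
    ∑ i ∈ Finset.Icc 1 n, (p i * Real.log 2 - (slope r b β i * a i) ^ (γ / (γ - 1)) / γ +
      β * a i * (slope r b β i * a i) ^ (1 / (γ - 1))) = phaseFreeEnergy γ p a n r b j β := by
  have hpow : ∀ x : ℝ, 0 < x → x * x ^ (1 / (γ - 1)) = x ^ (γ / (γ - 1)) := fun x hx => by
    rw [show γ / (γ - 1) = 1 + 1 / (γ - 1) by field_simp [(by linarith : γ - 1 ≠ 0)]; ring,
      Real.rpow_add hx, Real.rpow_one]
  refine sum_eq_phaseFreeEnergy hr0 hrK hr hj ?_ ?_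
  · intro i hi hin
    have hai := ha i (Finset.mem_Icc.2 ⟨by omega, hin⟩)
    rw [slope_eq_of_lt hrK hr hb hj hβj' hi hin, hpow _ (by positivity)]
    field_simp
    ring
  · intro l hl
    have hlK : l < K := by omega
    have hbl : 0 < b (l + 1) := by
      have := le_of_forall_lt_succ hb (Nat.zero_le l) hlK.le
      have := hb l hlK
      linarith
    set c := b (l + 1)
    have h1 : ∑ i ∈ Finset.Icc (r l + 1) (r (l + 1)),
        (p i * Real.log 2 - (slope r b β i * a i) ^ (γ / (γ - 1)) / γ +
          β * a i * (slope r b β i * a i) ^ (1 / (γ - 1))) =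
        ∑ i ∈ Finset.Icc (r l + 1) (r (l + 1)), (Real.log 2 * p i +
          (β * c ^ (1 / (γ - 1)) - c ^ (γ / (γ - 1)) / γ) * a i ^ (γ / (γ - 1))) := by
      refine Finset.sum_congr rfl fun i hi => ?_
      have hai := pos_of_mem_block hrK hr ha hlK hi
      rw [slope_eq_of_mem hr hb hj hβj hl hi, Real.mul_rpow hbl.le hai.le,
        Real.mul_rpow hbl.le hai.le, ← hpow _ hai]
      ring
    rw [h1, Finset.sum_add_distrib, ← Finset.mul_sum, ← Finset.mul_sum]
    have h4 : Real.log 2 * ∑ i ∈ Finset.Icc (r l + 1) (r (l + 1)), p i =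
      c ^ (γ / (γ - 1)) * (∑ i ∈ Finset.Icc (r l + 1) (r (l + 1)), a i ^ (γ / (γ - 1))) / γ := by
      rw [heq l hlK]
      field_simp
    rw [h4]
    ring

/-- The optimal slopes have nonnegative entropy up to every level. -/
lemma entropy_nonneg {β : ℝ} (hβ : 0 < β)
    (hle : ∀ l < K, ∀ m, r l < m → m ≤ n → b (l + 1) ^ (γ / (γ - 1)) *
        ∑ i ∈ Finset.Icc (r l + 1) m, a i ^ (γ / (γ - 1))
        ≤ (∑ i ∈ Finset.Icc (r l + 1) m, p i) * γ * Real.log 2) {m : ℕ} (hm : m ≤ n) :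
    0 ≤ ∑ i ∈ Finset.Icc 1 m, (p i * Real.log 2 - (slope r b β i * a i) ^ (γ / (γ - 1)) / γ) := by
  have key : ∀ l ≤ K, ∀ m ≤ r l, 0 ≤ ∑ i ∈ Finset.Icc 1 m,
      (p i * Real.log 2 - (slope r b β i * a i) ^ (γ / (γ - 1)) / γ) := by
    intro l
    induction l with
    | zero =>
      intro _ m hm
      have : m = 0 := by omega
      simp [this]
    | succ l ih =>
      intro hl m hm
      rcases le_or_gt m (r l) with hml | hml
      · exact ih (by omega) m hml
      · rw [← sum_Icc_add_sum_Icc _ (show 1 ≤ r l + 1 by omega) hml.le]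
        refine add_nonneg (ih (by omega) _ le_rfl) ?_
        have hmn : m ≤ n := hm.trans (hrK ▸ le_of_forall_lt_succ hr hl le_rfl)
        have hbl : 0 < b (l + 1) := by
          have := le_of_forall_lt_succ hb (Nat.zero_le l) (by omega : l ≤ K)
          have := hb l hl
          linarith
        -- The slope is at most the critical parameter of its block, and raising it to that value
        -- only lowers the entropy; minimality of the parameter (`hle`) then covers an initial piece
        -- of the block.
        have h1 : ∑ i ∈ Finset.Icc (r l + 1) m, (p i * Real.log 2 -
            b (l + 1) ^ (γ / (γ - 1)) * a i ^ (γ / (γ - 1)) / γ) ≤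
            ∑ i ∈ Finset.Icc (r l + 1) m,
              (p i * Real.log 2 - (slope r b β i * a i) ^ (γ / (γ - 1)) / γ) := by
          refine Finset.sum_le_sum fun i hi => ?_
          obtain ⟨g1, g2⟩ := Finset.mem_Icc.1 hi
          have hi1 : i ∈ Finset.Icc 1 n := Finset.mem_Icc.2 ⟨by omega, by omega⟩
          have hai := ha i hi1
          have hs := (slope_pos_and_le hr0 hrK hr hb0 hb hβ hi1).1
          have hsb : slope r b β i ≤ b (l + 1) := by
            rw [slope, level_eq hr hl (Finset.mem_Icc.2 ⟨g1, by omega⟩)]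
            exact min_le_left _ _
          rw [← Real.mul_rpow hbl.le hai.le]
          have : 0 ≤ γ / (γ - 1) := div_nonneg (by linarith) (by linarith)
          gcongr
        refine le_trans ?_ h1
        rw [Finset.sum_sub_distrib, ← Finset.sum_mul, ← Finset.sum_div, ← Finset.mul_sum,
          sub_nonneg, div_le_iff₀ (by linarith)]
        have := hle l hl m hml hmn
        linarith
  exact key K le_rfl m (by omega)

end Scheme

/-! ### The limit, for fixed and then for all inverse temperatures. -/

section FreeEnergy

variable {Ω : Type*} [MeasurableSpace Ω] {P : Measure Ω} [IsProbabilityMeasure P]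
  {γ : ℝ} {n : ℕ} {k : ℕ → ℕ → ℕ} {p : ℕ → ℝ} {ξ : (N : ℕ) → Node k n N → Ω → ℝ}

/-- The lower bound on the free energy, for slopes with nonnegative entropy. -/
lemma ae_eventually_lt_freeEnergy_of_slope (hγ : 1 < γ) (hn : 1 ≤ n)
    (hp : ∀ i ∈ Finset.Icc 1 n, Tendsto (fun N : ℕ => (k i N : ℝ) / N) atTop (𝓝 (p i)))
    (hp0 : ∀ i ∈ Finset.Icc 1 n, 0 ≤ p i) (hp1 : 0 < p 1)
    (hξ_indep : ∀ N ≥ n, iIndepFun (ξ N) P)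
    (hξ_law : ∀ N ≥ n, ∀ v, HasLaw (ξ N v) (drivingLaw γ N) P)
    {a lam : ℕ → ℝ} {β : ℝ} (hβ : 0 ≤ β) (ha : ∀ i ∈ Finset.Icc 1 n, 0 < a i)
    (hlam : ∀ i ∈ Finset.Icc 1 n, 0 < lam i)
    (hent : ∀ m ∈ Finset.Icc 1 n,
      0 ≤ ∑ i ∈ Finset.Icc 1 m, (p i * Real.log 2 - (lam i * a i) ^ (γ / (γ - 1)) / γ))
    {ε : ℝ} (hε : 0 < ε) :
    ∀ᵐ ω ∂P, ∀ᶠ N : ℕ in atTop,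
      ∑ i ∈ Finset.Icc 1 n, (p i * Real.log 2 - (lam i * a i) ^ (γ / (γ - 1)) / γ +
        β * a i * (lam i * a i) ^ (1 / (γ - 1))) - ε <
        1 / (N : ℝ) * Real.log (partitionFunction a (fun v => ξ N v ω) β) := by
  have hγ1 : γ - 1 ≠ 0 := by linarith
  have hγ0 : 0 < γ := by linarith
  have hla : ∀ i ∈ Finset.Icc 1 n, 0 ≤ lam i * a i := fun i hi =>
    (mul_pos (hlam i hi) (ha i hi)).le
  have hcont : Continuous fun s : ℝ => ∑ i ∈ Finset.Icc 1 n, (p i * Real.log 2 -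
      s ^ γ * (lam i * a i) ^ (γ / (γ - 1)) / γ +
        β * a i * (s * (lam i * a i) ^ (1 / (γ - 1)))) := by
    refine continuous_finsetSum _ fun i _ => ?_
    have : Continuous fun s : ℝ => s ^ γ := Real.continuous_rpow_const hγ0.le
    fun_prop
  have hev := (hcont.tendsto 1).eventually (lt_mem_nhds (sub_lt_self _ (half_pos hε)))
  -- The entropies may vanish, but the second moment bound needs them positive. Shrinking the
  -- profile by `s < 1` multiplies its cost by s^γ and frees (1 - s^γ) log 2 ∑ p i > 0, since `p 1 >
  -- 0`; by continuity the value changes by less than `ε / 2`.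
  obtain ⟨s, hs, hs1, hs0⟩ := ((hev.filter_mono (nhdsWithin_le_nhds (s := Set.Iio 1))).and
    ((eventually_mem_nhdsWithin (a := (1 : ℝ)) (s := Set.Iio 1)).and
      (eventually_nhdsWithin_of_eventually_nhds (lt_mem_nhds one_pos)))).exists
  simp only [Set.mem_Iio] at hs1
  simp only [Real.one_rpow, one_mul] at hs
  have htpow : ∀ i ∈ Finset.Icc 1 n, (s * (lam i * a i) ^ (1 / (γ - 1))) ^ γ =
      s ^ γ * (lam i * a i) ^ (γ / (γ - 1)) := fun i hi => by
    have := hla i hi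
    rw [Real.mul_rpow hs0.le (by positivity), ← Real.rpow_mul this,
      show 1 / (γ - 1) * γ = γ / (γ - 1) by ring]
  have hsγ1 : s ^ γ < 1 := Real.rpow_lt_one hs0.le hs1 hγ0
  have hsγ0 : 0 < s ^ γ := Real.rpow_pos_of_pos hs0 _
  have hlog := Real.log_pos one_lt_two
  have main := ae_eventually_lt_freeEnergy hγ hn hp hξ_indep hξ_law hβ ha
    (t := fun i => s * (lam i * a i) ^ (1 / (γ - 1)))
    (fun i hi => mul_nonneg hs0.le (Real.rpow_nonneg (hla i hi) _)) (fun m hm => ?_) (half_pos hε)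
  · have e : ∑ i ∈ Finset.Icc 1 n, (p i * Real.log 2 -
        (s * (lam i * a i) ^ (1 / (γ - 1))) ^ γ / γ +
          β * a i * (s * (lam i * a i) ^ (1 / (γ - 1)))) =
        ∑ i ∈ Finset.Icc 1 n, (p i * Real.log 2 -
        s ^ γ * (lam i * a i) ^ (γ / (γ - 1)) / γ +
          β * a i * (s * (lam i * a i) ^ (1 / (γ - 1)))) :=
      Finset.sum_congr rfl fun i hi => by rw [htpow i hi]
    filter_upwards [main] with ω hω
    filter_upwards [hω] with N hN
    rw [e] at hN
    linarith
  · obtain ⟨hm1, hmn⟩ := Finset.mem_Icc.1 hm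
    have e : ∑ i ∈ Finset.Icc 1 m, (p i * Real.log 2 -
        (s * (lam i * a i) ^ (1 / (γ - 1))) ^ γ / γ) =
        s ^ γ * ∑ i ∈ Finset.Icc 1 m, (p i * Real.log 2 - (lam i * a i) ^ (γ / (γ - 1)) / γ) +
          (1 - s ^ γ) * Real.log 2 * ∑ i ∈ Finset.Icc 1 m, p i := by
      rw [Finset.mul_sum, Finset.mul_sum, ← Finset.sum_add_distrib]
      refine Finset.sum_congr rfl fun i hi => ?_
      rw [htpow i (Finset.Icc_subset_Icc_right hmn hi)]
      ring
    rw [e]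
    have h1 : 0 < ∑ i ∈ Finset.Icc 1 m, p i :=
      Finset.sum_pos' (fun i hi => hp0 i (Finset.Icc_subset_Icc_right hmn hi))
        ⟨1, by simp [hm1], hp1⟩
    have h2 := hent m hm
    have h3 : 0 < 1 - s ^ γ := by linarith
    positivity

/-- The free energy at a fixed inverse temperature. -/
lemma ae_tendsto_freeEnergy (hγ : 1 < γ) (hn : 1 ≤ n)
    (hk_sum : ∀ N ≥ n, ∑ i ∈ Finset.Icc 1 n, k i N = N)
    (hp : ∀ i ∈ Finset.Icc 1 n, Tendsto (fun N : ℕ => (k i N : ℝ) / N) atTop (𝓝 (p i)))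
    (hp0 : ∀ i ∈ Finset.Icc 1 n, 0 ≤ p i) (hp1 : 0 < p 1)
    (hξ_indep : ∀ N ≥ n, iIndepFun (ξ N) P)
    (hξ_law : ∀ N ≥ n, ∀ v, HasLaw (ξ N v) (drivingLaw γ N) P)
    {a : ℕ → ℝ} (ha : ∀ i ∈ Finset.Icc 1 n, 0 < a i) {K : ℕ} {r : ℕ → ℕ} {b : ℕ → ℝ}
    (hr0 : r 0 = 0) (hrK : r K = n) (hr : ∀ l < K, r l < r (l + 1)) (hb0 : b 0 = 0)
    (hb : ∀ l < K, b l < b (l + 1))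
    (heq : ∀ l < K, b (l + 1) ^ (γ / (γ - 1)) *
        ∑ i ∈ Finset.Icc (r l + 1) (r (l + 1)), a i ^ (γ / (γ - 1))
        = (∑ i ∈ Finset.Icc (r l + 1) (r (l + 1)), p i) * γ * Real.log 2)
    (hle : ∀ l < K, ∀ m, r l < m → m ≤ n → b (l + 1) ^ (γ / (γ - 1)) *
        ∑ i ∈ Finset.Icc (r l + 1) m, a i ^ (γ / (γ - 1))
        ≤ (∑ i ∈ Finset.Icc (r l + 1) m, p i) * γ * Real.log 2)
    {β : ℝ} {j : ℕ} (hj : j ≤ K) (hβj : b j < β) (hβj' : j < K → β ≤ b (j + 1)) :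
    ∀ᵐ ω ∂P, Tendsto (fun N : ℕ => 1 / (N : ℝ) *
      Real.log (partitionFunction a (fun v => ξ N v ω) β)) atTop
      (𝓝 (phaseFreeEnergy γ p a n r b j β)) := by
  have hβ : 0 < β := by
    have := le_of_forall_lt_succ hb (Nat.zero_le j) hj
    linarith
  have hs := fun i hi => slope_pos_and_le hr0 hrK hr hb0 hb hβ (i := i) hi
  have hpos : ∀ s : ℕ, (0 : ℝ) < 1 / (s + 1) := fun s => by positivity
  have hup := ae_all_iff.2 fun s : ℕ => ae_eventually_freeEnergy_le hγ hn hk_sum hp hξ_indep hξ_law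
    ha hs (fun i j _ hij hjn => slope_mono hrK hb β hij hjn) (hpos s)
  have hlow := ae_all_iff.2 fun s : ℕ => ae_eventually_lt_freeEnergy_of_slope hγ hn hp hp0 hp1
    hξ_indep hξ_law hβ.le ha (fun i hi => (hs i hi).1)
    (fun m hm => entropy_nonneg hr0 hrK hr hb0 hb hγ ha hβ hle (Finset.mem_Icc.1 hm).2) (hpos s)
  rw [upper_sum_eq hr0 hrK hr hb0 hb hγ ha hj hβ hβj hβj' heq] at hup
  rw [lower_sum_eq hr0 hrK hr hb0 hb hγ ha hj hβ hβj hβj' heq] at hlow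
  filter_upwards [hup, hlow] with ω h1 h2
  rw [Metric.tendsto_atTop']
  intro ε hε
  obtain ⟨s, hsε⟩ := exists_nat_one_div_lt hε
  obtain ⟨M, hM⟩ := eventually_atTop.1 ((h1 s).and (h2 s))
  refine ⟨M, fun N hN => ?_⟩
  obtain ⟨g1, g2⟩ := hM N hN.le
  rw [Real.dist_eq, abs_lt]
  constructor <;> linarith

lemma continuous_phaseFreeEnergy (hγ : 1 < γ) (a : ℕ → ℝ) (r : ℕ → ℕ) (b : ℕ → ℝ) (j : ℕ) :
    Continuous (phaseFreeEnergy γ p a n r b j) := by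
  unfold phaseFreeEnergy
  have : Continuous fun s : ℝ => s ^ (γ / (γ - 1)) :=
    Real.continuous_rpow_const (div_nonneg (by linarith) (by linarith))
  refine (continuous_const.add (continuous_const.mul
    (continuous_finsetSum _ fun i _ => this.comp (by fun_prop)))).add (by fun_prop)

/-- The free energy, almost surely at all inverse temperatures. -/
lemma ae_forall_tendsto_freeEnergy (hγ : 1 < γ) (hn : 1 ≤ n)
    (hk_sum : ∀ N ≥ n, ∑ i ∈ Finset.Icc 1 n, k i N = N)
    (hp : ∀ i ∈ Finset.Icc 1 n, Tendsto (fun N : ℕ => (k i N : ℝ) / N) atTop (𝓝 (p i)))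
    (hp0 : ∀ i ∈ Finset.Icc 1 n, 0 ≤ p i) (hp1 : 0 < p 1)
    (hξ_indep : ∀ N ≥ n, iIndepFun (ξ N) P)
    (hξ_law : ∀ N ≥ n, ∀ v, HasLaw (ξ N v) (drivingLaw γ N) P)
    {a : ℕ → ℝ} (ha : ∀ i ∈ Finset.Icc 1 n, 0 < a i) {K : ℕ} {r : ℕ → ℕ} {b : ℕ → ℝ}
    (hr0 : r 0 = 0) (hrK : r K = n) (hr : ∀ l < K, r l < r (l + 1)) (hb0 : b 0 = 0)
    (hb : ∀ l < K, b l < b (l + 1))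
    (heq : ∀ l < K, b (l + 1) ^ (γ / (γ - 1)) *
        ∑ i ∈ Finset.Icc (r l + 1) (r (l + 1)), a i ^ (γ / (γ - 1))
        = (∑ i ∈ Finset.Icc (r l + 1) (r (l + 1)), p i) * γ * Real.log 2)
    (hle : ∀ l < K, ∀ m, r l < m → m ≤ n → b (l + 1) ^ (γ / (γ - 1)) *
        ∑ i ∈ Finset.Icc (r l + 1) m, a i ^ (γ / (γ - 1))
        ≤ (∑ i ∈ Finset.Icc (r l + 1) m, p i) * γ * Real.log 2) :
    ∀ᵐ ω ∂P, ∀ β : ℝ, ∀ j ≤ K, b j < β → (j < K → β ≤ b (j + 1)) →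
      Tendsto (fun N : ℕ => 1 / (N : ℝ) *
        Real.log (partitionFunction a (fun v => ξ N v ω) β)) atTop
        (𝓝 (phaseFreeEnergy γ p a n r b j β)) := by
  obtain ⟨C, hC⟩ := ae_exists_abs_hamiltonian_le hγ hn hk_sum hξ_indep hξ_law a
  have hrat : ∀ᵐ ω ∂P, ∀ (x : ℚ) (j : ℕ), j ≤ K ∧ b j < x ∧ (j < K → (x : ℝ) ≤ b (j + 1)) →
      Tendsto (fun N : ℕ => 1 / (N : ℝ) *
        Real.log (partitionFunction a (fun v => ξ N v ω) x)) atTop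
        (𝓝 (phaseFreeEnergy γ p a n r b j x)) := by
    refine ae_all_iff.2 fun x => ae_all_iff.2 fun j => ?_
    by_cases h : j ≤ K ∧ b j < x ∧ (j < K → (x : ℝ) ≤ b (j + 1))
    · filter_upwards [ae_tendsto_freeEnergy hγ hn hk_sum hp hp0 hp1 hξ_indep hξ_law ha hr0 hrK hr
        hb0 hb heq hle h.1 h.2.1 h.2.2] with ω hω _ using hω
    · exact Eventually.of_forall fun ω h' => absurd h' h
  filter_upwards [hC, hrat] with ω hω hr β j hj hβj hβj'
  rw [Metric.tendsto_atTop']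
  intro ε hε
  have hF := (continuous_phaseFreeEnergy (n := n) (p := p) hγ a r b j).tendsto β
  have hev1 : ∀ᶠ x in 𝓝 β, |phaseFreeEnergy γ p a n r b j x - phaseFreeEnergy γ p a n r b j β| <
      ε / 3 := hF.eventually (Metric.ball_mem_nhds _ (by positivity))
  have hev2 : ∀ᶠ x in 𝓝 β, |x - β| * |C| < ε / 3 := by
    have : Continuous fun x : ℝ => |x - β| * |C| := by fun_prop
    refine (this.tendsto β).eventually (gt_mem_nhds ?_)
    simpa using by positivity
  obtain ⟨d, hd, hball⟩ := Metric.eventually_nhds_iff.1 (hev1.and hev2)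
  -- Approximating `β` from below stays in phase `j`, even when `β` equals the next critical
  -- parameter.
  obtain ⟨x, hx1, hx2⟩ := exists_rat_btwn (show max (b j) (β - d) < β from
    max_lt hβj (by linarith))
  have hxd : dist (x : ℝ) β < d := by
    rw [Real.dist_eq, abs_lt]
    have := (le_max_right _ _).trans_lt hx1
    constructor <;> linarith
  obtain ⟨hx3, hx4⟩ := hball hxd
  have hx := hr x j ⟨hj, (le_max_left _ _).trans_lt hx1, fun h => hx2.le.trans (hβj' h)⟩
  have hx5 := hx.eventually (Metric.ball_mem_nhds _ (show 0 < ε / 3 by positivity))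
  obtain ⟨M, hM⟩ := eventually_atTop.1 (hx5.and (hω.and (eventually_gt_atTop 0)))
  refine ⟨M, fun N hN => ?_⟩
  obtain ⟨g1, g2, g3⟩ := hM N hN.le
  have hN0 : (0 : ℝ) < N := by exact_mod_cast g3
  have hlip : ∀ y z : ℝ, |y - z| = |(x : ℝ) - β| →
      1 / (N : ℝ) * Real.log (partitionFunction a (fun v => ξ N v ω) y) ≤
      1 / (N : ℝ) * Real.log (partitionFunction a (fun v => ξ N v ω) z) + |(x : ℝ) - β| * |C| := by
    intro y z hyz
    have h1 := log_partitionFunction_le_add (β := y) (β' := z) g2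
    rw [hyz] at h1
    have h2 := mul_le_mul_of_nonneg_left h1 (show 0 ≤ 1 / (N : ℝ) by positivity)
    refine h2.trans ?_
    rw [mul_add, mul_left_comm (1 / (N : ℝ)), ← mul_assoc (1 / (N : ℝ)), one_div_mul_cancel hN0.ne',
      one_mul]
    gcongr
    exact le_abs_self C
  have k1 := hlip x β rfl
  have k2 := hlip β x (abs_sub_comm _ _)
  rw [Real.dist_eq, abs_lt] at g1
  rw [abs_lt] at hx3
  rw [Real.dist_eq, abs_lt]
  constructor <;> linarith [g1.1, g1.2, hx3.1, hx3.2]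

end FreeEnergy

/-! ### Closed forms for γ = 2 and for the last phase. -/

section Gaussian

lemma B_two (p a : ℕ → ℝ) (j m : ℕ) :
    B 2 p a j m =
      √(2 * Real.log 2 * (∑ i ∈ Finset.Icc j m, p i) / ∑ i ∈ Finset.Icc j m, a i ^ 2) := by
  rw [B, Real.sqrt_eq_rpow, show ((2 : ℝ) - 1) / 2 = 1 / 2 by norm_num,
    show (2 : ℝ) / (2 - 1) = (2 : ℕ) by norm_num]
  simp only [Real.rpow_natCast]
  congr 2
  ring

lemma phaseFreeEnergy_two (p a : ℕ → ℝ) (n : ℕ) (r : ℕ → ℕ) (b : ℕ → ℝ) (j : ℕ) (β : ℝ) :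
    phaseFreeEnergy 2 p a n r b j β = ∑ i ∈ Finset.Icc (r j + 1) n, p i * Real.log 2
      + β ^ 2 / 2 * ∑ i ∈ Finset.Icc (r j + 1) n, a i ^ 2
      + β * ∑ l ∈ Finset.Icc 1 j, b l * ∑ i ∈ Finset.Icc (r (l - 1) + 1) (r l), a i ^ 2 := by
  rw [phaseFreeEnergy, show (1 : ℝ) / (2 - 1) = 1 by norm_num,
    show (2 : ℝ) / (2 - 1) = (2 : ℕ) by norm_num]
  simp only [Real.rpow_natCast, Real.rpow_one, mul_pow, ← Finset.mul_sum]
  ring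

lemma phaseFreeEnergy_last {γ : ℝ} {p a : ℕ → ℝ} {n K : ℕ} {r : ℕ → ℕ} {b : ℕ → ℝ}
    (hrK : r K = n) (β : ℝ) :
    phaseFreeEnergy γ p a n r b K β = β * ∑ l ∈ Finset.Icc 1 K, b l ^ (1 / (γ - 1)) *
      ∑ i ∈ Finset.Icc (r (l - 1) + 1) (r l), a i ^ (γ / (γ - 1)) := by
  simp [phaseFreeEnergy, hrK]

end Gaussian

end GREM

end

theorem theorem2p6p1
    {Ω : Type*} [MeasurableSpace Ω] (P : Measure Ω) [IsProbabilityMeasure P]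
    (γ : ℝ) (hγ : 1 < γ)
    (n : ℕ) (hn : 1 ≤ n)
    (a : ℕ → ℝ) (ha : ∀ i ∈ Finset.Icc 1 n, 0 < a i)
    (k : ℕ → ℕ → ℕ)
    (hk_pos : ∀ N ≥ n, ∀ i ∈ Finset.Icc 1 n, 1 ≤ k i N)
    (hk_sum : ∀ N ≥ n, ∑ i ∈ Finset.Icc 1 n, k i N = N)
    (p : ℕ → ℝ)
    (hp : ∀ i ∈ Finset.Icc 1 n, Tendsto (fun N : ℕ => (k i N : ℝ) / N) atTop (𝓝 (p i)))
    (hp_one : 0 < p 1)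
    (ξ : (N : ℕ) → GREM.Node k n N → Ω → ℝ)
    (hξ_indep : ∀ N ≥ n, iIndepFun (ξ N) P)
    (hξ_law : ∀ N ≥ n, ∀ v, HasLaw (ξ N v) (GREM.drivingLaw γ N) P) :
    ∃ K : ℕ, 1 ≤ K ∧ K ≤ n ∧
      GREM.critIndex γ p a n K = n ∧
      (∀ l < K, GREM.critIndex γ p a n l < GREM.critIndex γ p a n (l + 1)) ∧
      (∀ l < K, GREM.critBeta γ p a n l < GREM.critBeta γ p a n (l + 1)) ∧
      -- the free energy
      (∀ᵐ ω ∂P, ∀ β : ℝ,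
        (∀ j < K, GREM.critBeta γ p a n j < β → β ≤ GREM.critBeta γ p a n (j + 1) →
          Tendsto
            (fun N : ℕ => 1 / (N : ℝ) *
              Real.log (GREM.partitionFunction a (fun v => ξ N v ω) β))
            atTop
            (𝓝 (∑ i ∈ Finset.Icc (GREM.critIndex γ p a n j + 1) n, p i * Real.log 2
              + (γ - 1) / γ * ∑ i ∈ Finset.Icc (GREM.critIndex γ p a n j + 1) n,
                  (β * a i) ^ (γ / (γ - 1))
              + β * ∑ l ∈ Finset.Icc 1 j, GREM.critBeta γ p a n l ^ (1 / (γ - 1)) *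
                  ∑ i ∈ Finset.Icc (GREM.critIndex γ p a n (l - 1) + 1)
                    (GREM.critIndex γ p a n l), a i ^ (γ / (γ - 1))))) ∧
        (GREM.critBeta γ p a n K < β →
          Tendsto
            (fun N : ℕ => 1 / (N : ℝ) *
              Real.log (GREM.partitionFunction a (fun v => ξ N v ω) β))
            atTop
            (𝓝 (β * ∑ l ∈ Finset.Icc 1 K, GREM.critBeta γ p a n l ^ (1 / (γ - 1)) *
                  ∑ i ∈ Finset.Icc (GREM.critIndex γ p a n (l - 1) + 1)
                    (GREM.critIndex γ p a n l), a i ^ (γ / (γ - 1)))))) ∧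
      -- the Gaussian case
      (γ = 2 →
        (∀ N ≥ n, ∀ v, HasLaw (ξ N v) (gaussianReal 0 (N : ℝ≥0)) P) ∧
        (∀ j m : ℕ, 1 ≤ j → j ≤ m → m ≤ n →
          GREM.B γ p a j m =
            √(2 * Real.log 2 * (∑ i ∈ Finset.Icc j m, p i) / ∑ i ∈ Finset.Icc j m, a i ^ 2)) ∧
        (∀ᵐ ω ∂P, ∀ β : ℝ,
          (∀ j < K, GREM.critBeta γ p a n j < β → β ≤ GREM.critBeta γ p a n (j + 1) →
            Tendsto
              (fun N : ℕ => 1 / (N : ℝ) *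
                Real.log (GREM.partitionFunction a (fun v => ξ N v ω) β))
              atTop
              (𝓝 (∑ i ∈ Finset.Icc (GREM.critIndex γ p a n j + 1) n, p i * Real.log 2
                + β ^ 2 / 2 * ∑ i ∈ Finset.Icc (GREM.critIndex γ p a n j + 1) n, a i ^ 2
                + β * ∑ l ∈ Finset.Icc 1 j, GREM.critBeta γ p a n l *
                    ∑ i ∈ Finset.Icc (GREM.critIndex γ p a n (l - 1) + 1)
                      (GREM.critIndex γ p a n l), a i ^ 2))) ∧
          (GREM.critBeta γ p a n K < β →
            Tendsto
              (fun N : ℕ => 1 / (N : ℝ) *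
                Real.log (GREM.partitionFunction a (fun v => ξ N v ω) β))
              atTop
              (𝓝 (β * ∑ l ∈ Finset.Icc 1 K, GREM.critBeta γ p a n l *
                    ∑ i ∈ Finset.Icc (GREM.critIndex γ p a n (l - 1) + 1)
                      (GREM.critIndex γ p a n l), a i ^ 2))))) := by
  have hp0 : ∀ i ∈ Finset.Icc 1 n, 0 ≤ p i := fun i hi =>
    ge_of_tendsto' (hp i hi) fun N => by positivity
  obtain ⟨K, hK1, hKn, hrK, hr, hb, heq, hle⟩ :=
    GREM.exists_critical_scheme hγ ha hp0 hn hp_one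
  have main := GREM.ae_forall_tendsto_freeEnergy hγ hn hk_sum hp hp0 hp_one hξ_indep hξ_law ha
    (r := GREM.critIndex γ p a n) (b := GREM.critBeta γ p a n) rfl hrK hr rfl hb heq hle
  refine ⟨K, hK1, hKn, hrK, hr, hb, ?_, ?_⟩
  · filter_upwards [main] with ω hω β
    refine ⟨fun j hj h1 h2 => hω β j hj.le h1 fun _ => h2, fun h => ?_⟩
    rw [← GREM.phaseFreeEnergy_last (p := p) hrK]
    exact hω β K le_rfl h fun h' => absurd h' (lt_irrefl K)
  · rintro rfl
    refine ⟨fun N hN v => ?_, fun j m _ _ _ => GREM.B_two p a j m, ?_⟩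
    · rw [← GREM.drivingLaw_two (by omega)]
      exact hξ_law N hN v
    · filter_upwards [main] with ω hω β
      refine ⟨fun j hj h1 h2 => ?_, fun h => ?_⟩
      · rw [← GREM.phaseFreeEnergy_two p a n _ (GREM.critBeta 2 p a n)]
        exact hω β j hj.le h1 fun _ => h2
      · have h3 := hω β K le_rfl h fun h' => absurd h' (lt_irrefl K)
        rw [GREM.phaseFreeEnergy_two, hrK, Finset.Icc_eq_empty (by omega), Finset.sum_empty,
          Finset.sum_empty, mul_zero, add_zero, zero_add] at h3
        exact h3
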